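/- **Setting.** Let $k\ge 0$. A *$k$-partition diagram* is an equivalence relation on $\underline k\cup\underline k'$, where $\underline k=\{1,\dots,k\}$ is the top row and $\underline k'=\{1',\dots,k'\}$ the bottom row. A *diagram of the algebra of $\mathbb Z_2$-relations* is an equivalence relation on $(\underline k\cup\underline k')\times\mathbb Z_2$ that is stable under the action $g.(i,h)=(i,gh)$ of $\mathbb Z_2=\{e,g\}$; its top row is $\underline k\times\mathbb Z_2$ and its bottom row $\underline k'\times\mathbb Z_2$. Equivalence classes are called connected components. A component meeting both rows is a *through class*; a component inside one row is a *horizontal edge*. A component $C$ of a $\mathbb Z_2$-stable diagram is a *$\mathbb Z_2$-class* if $gC=C$ and an *$\{e\}$-class* if $gC\cap C=\emptyset$; $\{e\}$-classes occur in pairs $C,gC$. Only diagrams are considered in which the relation on the bottom row is the copy of the relation on the top row and every top-row vertex belonging to a through class is equivalent to its copy in the bottom row. For such diagrams the horizontal edges of the top row are counted (those of the bottom row are their copies). Let $J^{2k}_{2s_1+s_2}$ be the set of such $\mathbb Z_2$-stable diagrams with $s_1$ pairs of $\{e\}$-through classes and $s_2$ $\mathbb Z_2$-through classes, and $J^k_s$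 the set of such $k$-partition diagrams with $s$ through classes. "$2r_1+r_2$ horizontal edges" means $r_1$ pairs of $\{e\}$-horizontal edges and $r_2$ $\mathbb Z_2$-horizontal edges. For $d,d'\in J^{2k}_{2s_1+s_2}$, $d'$ is *coarser* than $d$ if: each $\{e\}$-through class of $d$ is contained in an $\{e\}$-through class of $d'$; each $\mathbb Z_2$-through class of $d$ is contained in a $\mathbb Z_2$-through class of $d'$; each $\{e\}$-horizontal edge of $d$ is contained in a horizontal edge or through class of $d'$ (of either type); each $\mathbb Z_2$-horizontal edge of $d$ is contained in a $\mathbb Z_2$-horizontal edge or $\mathbb Z_2$-through class of $d'$; and different through classes of $d$ lie in different through classes of $d'$. For $d,d'\in J^k_s$, $d'$ is coarser than $d$ if each through class of $d$ is contained in a through class of $d'$, different ones in different ones, and each horizontal edge of $d$ is contained in a horizontal edge or through class of $d'$. (So $d$ is coarser than itself.) $S(n,m)$ denotes the Stirling numbers of the second kind; $0^0=1$, and a sum over an empty range is $0$. **Lemma.** (a) Let $d\in J^{2k}_{2s_1+s_2}$ have $2r_1+r_2$ horizontal edges. For all $p_1,p_2\ge 0$ the number of diagrams in $J^{2k}_{2s_1+s_2}$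 that have $2p_1+p_2$ horizontal edges and are coarser than $d$ is $$\sum_{i=p_1}^{r_1}\binom{r_1}{i}2^{i-p_1}S(i,p_1)\left[\sum_{j=0}^{r_1-i}\binom{r_1-i}{j}(2s_1+s_2)^{r_1-i-j}\left[\sum_{l=\max(p_2-j,0)}^{r_2}\binom{r_2}{l}s_2^{\,r_2-l}S(l+j,p_2)\right]\right].$$ In particular: (i) if $r_1=0$, the number of diagrams in $J^{2k}_{2s_1+s_2}$ that have $p_2$ $\mathbb Z_2$-horizontal edges and are coarser than $d$ is $\sum_{i=p_2}^{r_2}\binom{r_2}{i}s_2^{\,r_2-i}S(i,p_2)$; (ii) if $s_1=s_2=0$, the number of diagrams in $J^{2k}_{0}$ that have $2p_1+p_2$ horizontal edges and are coarser than $d$ is $\sum_{i=p_1}^{r_1}\binom{r_1}{i}2^{i-p_1}S(i,p_1)\,S(r_2+r_1-i,p_2)$. (b) Let $d\in J^k_s$ have $r$ horizontal edges. For all $p\ge 0$ the number of diagrams in $J^k_s$ that have $p$ horizontal edges and are coarser than $d$ is $\sum_{i=p}^{r}\binom{r}{i}s^{r-i}S(i,p)$. -/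

import Mathlib

/-! ### Two-row diagrams

A diagram with two rows, each indexed by `X`, is an equivalence relation on `X ⊕ X`; `Sum.inl x` is
the vertex `x` of the top row, `Sum.inr x` is the vertex `x'` below it.  Its connected components
are its equivalence classes. -/

namespace TwoRow

/-- A through class: a connected component that meets both rows. -/
def IsThroughClass {X : Type} (d : Setoid (X ⊕ X)) (C : Set (X ⊕ X)) : Prop :=
  C ∈ d.classes ∧ (∃ x, Sum.inl x ∈ C) ∧ (∃ x, Sum.inr x ∈ C)

/-- A horizontal edge of the top row: a connected component inside the top row. -/
def IsTopEdge {X : Type} (d : Setoid (X ⊕ X)) (C : Set (X ⊕ X)) : Prop :=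
  C ∈ d.classes ∧ C ⊆ Set.range Sum.inl

/-- A horizontal edge of the bottom row: a connected component inside the bottom row. -/
def IsBottomEdge {X : Type} (d : Setoid (X ⊕ X)) (C : Set (X ⊕ X)) : Prop :=
  C ∈ d.classes ∧ C ⊆ Set.range Sum.inr

/-- A horizontal edge: a connected component inside one of the two rows. -/
def IsHorizontalEdge {X : Type} (d : Setoid (X ⊕ X)) (C : Set (X ⊕ X)) : Prop :=
  IsTopEdge d C ∨ IsBottomEdge d C

/-- The diagrams `U_{(d,P)}^{(d,P)}`: both rows carry the same equivalence relation, and every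
block of the top row that belongs to a through class is joined to its own copy in the bottom row
(the permutation of the through classes is the identity). -/
def IsDoubled {X : Type} (d : Setoid (X ⊕ X)) : Prop :=
  (∀ x y : X, d (Sum.inl x) (Sum.inl y) ↔ d (Sum.inr x) (Sum.inr y)) ∧
  (∀ x y : X, d (Sum.inl x) (Sum.inr y) → d (Sum.inl x) (Sum.inr x))

/-- No connected component of `d'` contains two different through classes of `d`. -/
def SeparatesThrough {X : Type} (d d' : Setoid (X ⊕ X)) : Prop :=
  ∀ C₁ C₂ C' : Set (X ⊕ X), IsThroughClass d C₁ → IsThroughClass d C₂ → C' ∈ d'.classes →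
    C₁ ⊆ C' → C₂ ⊆ C' → C₁ = C₂

end TwoRow

/-! ### Partition diagrams -/

namespace PartitionDiagram

open TwoRow

/-- The set `J^k_s`: doubled `k`-partition diagrams with `s` through classes. -/
def J (k s : ℕ) : Set (Setoid (Fin k ⊕ Fin k)) :=
  {d | IsDoubled d ∧ {C | IsThroughClass d C}.ncard = s}

/-- The number of horizontal edges in (each row of) a doubled diagram. -/
noncomputable def numEdges {k : ℕ} (d : Setoid (Fin k ⊕ Fin k)) : ℕ :=
  {C | IsTopEdge d C}.ncard

/-- `d'` is coarser than `d` (for diagrams with the same number of through classes). -/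
def IsCoarser {k : ℕ} (d d' : Setoid (Fin k ⊕ Fin k)) : Prop :=
  (∀ C, IsThroughClass d C → ∃ C', IsThroughClass d' C' ∧ C ⊆ C') ∧
  (∀ C, IsHorizontalEdge d C →
    ∃ C', (IsHorizontalEdge d' C' ∨ IsThroughClass d' C') ∧ C ⊆ C') ∧
  SeparatesThrough d d'

end PartitionDiagram

/-! ### Diagrams of the algebra of `ℤ₂`-relations -/

namespace Z2Diagram

open TwoRow

/-- The vertices `(i, g)` of one row, `i` in `{1, …, k}` and `g` in `ℤ₂`. -/
abbrev Row (k : ℕ) : Type := Fin k × ZMod 2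

/-- The action `g.(i, h) = (i, gh)` of `ℤ₂` (written additively) on the vertices of both rows. -/
def act {k : ℕ} (g : ZMod 2) : Row k ⊕ Row k → Row k ⊕ Row k :=
  Sum.map (fun p => (p.1, g + p.2)) (fun p => (p.1, g + p.2))

/-- `ℤ₂`-stable equivalence relations. -/
def IsStable {k : ℕ} (d : Setoid (Row k ⊕ Row k)) : Prop :=
  ∀ (g : ZMod 2) (p q : Row k ⊕ Row k), d p q → d (act g p) (act g q)

/-- A connected component is an `{e}`-class if it never contains both `(i, e)` and `(i, g)`. -/
def IsEClass {k : ℕ} (d : Setoid (Row k ⊕ Row k)) (C : Set (Row k ⊕ Row k)) : Prop :=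
  C ∈ d.classes ∧ ∀ p ∈ C, act 1 p ∉ C

/-- A connected component is a `ℤ₂`-class if with each vertex it contains both `(i, e)`
and `(i, g)`. -/
def IsZ2Class {k : ℕ} (d : Setoid (Row k ⊕ Row k)) (C : Set (Row k ⊕ Row k)) : Prop :=
  C ∈ d.classes ∧ ∀ p ∈ C, act 1 p ∈ C

/-- The set `J^{2k}_{2s₁+s₂}`: doubled `ℤ₂`-stable diagrams with `s₁` pairs of `{e}`-through classes
and `s₂` many `ℤ₂`-through classes. -/
def J (k s₁ s₂ : ℕ) : Set (Setoid (Row k ⊕ Row k)) :=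
  {d | IsStable d ∧ IsDoubled d ∧
    {C | IsThroughClass d C ∧ IsEClass d C}.ncard = 2 * s₁ ∧
    {C | IsThroughClass d C ∧ IsZ2Class d C}.ncard = s₂}

/-- The number of `{e}`-horizontal edges in (each row of) a doubled diagram. -/
noncomputable def numEEdges {k : ℕ} (d : Setoid (Row k ⊕ Row k)) : ℕ :=
  {C | IsTopEdge d C ∧ IsEClass d C}.ncard

/-- The number of `ℤ₂`-horizontal edges in (each row of) a doubled diagram. -/
noncomputable def numZ2Edges {k : ℕ} (d : Setoid (Row k ⊕ Row k)) : ℕ :=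
  {C | IsTopEdge d C ∧ IsZ2Class d C}.ncard

/-- `d'` is coarser than `d` (for diagrams with the same numbers of through classes). -/
def IsCoarser {k : ℕ} (d d' : Setoid (Row k ⊕ Row k)) : Prop :=
  (∀ C, IsThroughClass d C → IsEClass d C →
    ∃ C', IsThroughClass d' C' ∧ IsEClass d' C' ∧ C ⊆ C') ∧
  (∀ C, IsThroughClass d C → IsZ2Class d C →
    ∃ C', IsThroughClass d' C' ∧ IsZ2Class d' C' ∧ C ⊆ C') ∧
  (∀ C, IsHorizontalEdge d C → IsEClass d C →
    ∃ C', (IsHorizontalEdge d' C' ∨ IsThroughClass d' C') ∧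
      (IsEClass d' C' ∨ IsZ2Class d' C') ∧ C ⊆ C') ∧
  (∀ C, IsHorizontalEdge d C → IsZ2Class d C →
    ∃ C', (IsHorizontalEdge d' C' ∨ IsThroughClass d' C') ∧ IsZ2Class d' C' ∧ C ⊆ C') ∧
  SeparatesThrough d d'

end Z2Diagram

/-! Let `Q` be the set of components that meet the top row, with the involution induced by `ℤ₂`, and
let `T ⊆ Q` be the through classes, `t = 2s₁ + s₂` in number, of which `s = s₂` are fixed. The
diagrams coarser than `d` correspond to the equivariant equivalence relations on `Q` that separate
the points of `T`. As in Rota's treatment of set partitions these are counted through maps: let `Y`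
be the union of `T`, of `a` further free orbits and of `b` further fixed points. The kernel of an
equivariant map `Q → Y` that extends the inclusion of `T` is such a relation, and the map is
determined by its kernel and an injective map on the quotient. Hence the numbers `N(p₁, p₂)` of
coarser diagrams satisfy, for all `a` and `b` and with `(x)_p` for the falling factorial,
`(2a + b + t) ^ r₁ (b + s) ^ r₂ = ∑ N(p₁, p₂) 2 ^ p₁ (a)_{p₁} (b)_{p₂}`.
By the binomial theorem and `x ^ n = ∑ S(n, p) (x)_p` the asserted formula satisfies the same
identity, and the falling factorials are linearly independent. Partition diagrams are the case of
the trivial involution. -/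

open Function
open Finset (range Icc)
open scoped Finset

/-! ### Stirling numbers and falling factorials -/

theorem pow_eq_sum_stirlingSecond_mul_descFactorial (x n : ℕ) :
    x ^ n = ∑ k ∈ range (x + 1), Nat.stirlingSecond n k * x.descFactorial k := by
  induction n with
  | zero =>
    rw [Finset.sum_range_succ',
      Finset.sum_eq_zero fun k _ => by rw [Nat.stirlingSecond_zero_succ, zero_mul]]
    simp
  | succ n ih =>
    have mul_descFactorial (k) (hk : k ∈ range (x + 1)) :
        x * x.descFactorial k = x.descFactorial (k + 1) + k * x.descFactorial k := by
      rw [Nat.descFactorial_succ, ← add_mul, Nat.sub_add_cancel (Finset.mem_range_succ_iff.1 hk)]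
    calc x ^ (n + 1) = ∑ k ∈ range (x + 1), Nat.stirlingSecond n k * (x * x.descFactorial k) := by
          rw [pow_succ', ih, Finset.mul_sum]
          exact Finset.sum_congr rfl fun k _ => by ring
      _ = ∑ k ∈ range (x + 1), Nat.stirlingSecond n k * x.descFactorial (k + 1) +
            ∑ k ∈ range (x + 1), Nat.stirlingSecond n k * (k * x.descFactorial k) := by
          rw [← Finset.sum_add_distrib]
          exact Finset.sum_congr rfl fun k hk => by rw [mul_descFactorial k hk, mul_add]
      _ = ∑ k ∈ range x, Nat.stirlingSecond n k * x.descFactorial (k + 1) +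
            ∑ k ∈ range x, Nat.stirlingSecond n (k + 1) * ((k + 1) * x.descFactorial (k + 1)) := by
          rw [Finset.sum_range_succ, Nat.descFactorial_eq_zero_iff_lt.2 x.lt_succ_self,
            Finset.sum_range_succ']
          simp
      _ = ∑ k ∈ range x, Nat.stirlingSecond (n + 1) (k + 1) * x.descFactorial (k + 1) := by
          rw [← Finset.sum_add_distrib]
          exact Finset.sum_congr rfl fun k _ => by rw [Nat.stirlingSecond_succ_succ]; ring
      _ = _ := by rw [Finset.sum_range_succ', Nat.stirlingSecond_succ_zero]; simp

theorem eq_of_sum_mul_descFactorial_eq {c c' : ℕ → ℕ}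
    (h : ∀ x, ∑ k ∈ range (x + 1), c k * x.descFactorial k =
      ∑ k ∈ range (x + 1), c' k * x.descFactorial k) : c = c' := by
  funext n
  induction n using Nat.strong_induction_on with
  | _ n ih =>
    have hlt : ∑ k ∈ range n, c k * n.descFactorial k = ∑ k ∈ range n, c' k * n.descFactorial k :=
      Finset.sum_congr rfl fun k hk => by rw [ih k (Finset.mem_range.1 hk)]
    have hn := h n
    rw [Finset.sum_range_succ, Finset.sum_range_succ, hlt, add_right_inj, Nat.descFactorial_self]
      at hn
    exact Nat.eq_of_mul_eq_mul_right n.factorial_pos hn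

theorem sum_choose_mul_pow_mul_pow (x s n : ℕ) :
    ∑ l ∈ range (n + 1), n.choose l * s ^ (n - l) * x ^ l = (x + s) ^ n := by
  rw [add_pow]
  exact Finset.sum_congr rfl fun l _ => by simp only [Nat.cast_id]; ring

/-- The innermost sum of the lemma: the number of ways to merge some of `r` fixed points into `s`
fixed through classes and to partition the others, together with `j` more points, into `q`
blocks. -/
def countFixed (s r j q : ℕ) : ℕ :=
  ∑ l ∈ Icc (q - j) r, r.choose l * s ^ (r - l) * Nat.stirlingSecond (l + j) q

/-- The formula of the lemma, with `t` for `2s₁ + s₂` and `s` for `s₂`. Of the `r₁` free orbits, `i`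
make up the `p₁` pairs of `{e}`-edges and `j` go into `ℤ₂`-edges; the others are merged into through
classes. -/
def countCoarser (t s r₁ r₂ p₁ p₂ : ℕ) : ℕ :=
  ∑ i ∈ Icc p₁ r₁, r₁.choose i * 2 ^ (i - p₁) * Nat.stirlingSecond i p₁ *
    ∑ j ∈ Icc 0 (r₁ - i), (r₁ - i).choose j * t ^ (r₁ - i - j) * countFixed s r₂ j p₂

theorem countFixed_eq_sum_range (s r j q : ℕ) :
    countFixed s r j q =
      ∑ l ∈ range (r + 1), r.choose l * s ^ (r - l) * Nat.stirlingSecond (l + j) q := by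
  refine Finset.sum_subset (fun l hl => ?_) fun l _ hl => ?_
  · exact Finset.mem_range_succ_iff.2 (Finset.mem_Icc.1 hl).2
  · rw [Finset.mem_Icc] at hl
    rw [Nat.stirlingSecond_eq_zero_of_lt (by grind), mul_zero]

theorem sum_countFixed_mul_descFactorial (s r j b : ℕ) :
    ∑ q ∈ range (b + 1), countFixed s r j q * b.descFactorial q = b ^ j * (b + s) ^ r :=
  calc
    _ = ∑ l ∈ range (r + 1), r.choose l * s ^ (r - l) *
          ∑ q ∈ range (b + 1), Nat.stirlingSecond (l + j) q * b.descFactorial q := by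
      simp_rw [countFixed_eq_sum_range, Finset.sum_mul, Finset.mul_sum, mul_assoc]
      exact Finset.sum_comm
    _ = b ^ j * ∑ l ∈ range (r + 1), r.choose l * s ^ (r - l) * b ^ l := by
      simp_rw [← pow_eq_sum_stirlingSecond_mul_descFactorial, pow_add, Finset.mul_sum]
      exact Finset.sum_congr rfl fun l _ => by ring
    _ = b ^ j * (b + s) ^ r := by rw [sum_choose_mul_pow_mul_pow]

theorem countCoarser_eq_sum_range (t s r₁ r₂ p₁ p₂ : ℕ) :
    countCoarser t s r₁ r₂ p₁ p₂ =
      ∑ i ∈ range (r₁ + 1), r₁.choose i * 2 ^ (i - p₁) * Nat.stirlingSecond i p₁ *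
        ∑ j ∈ range (r₁ - i + 1), (r₁ - i).choose j * t ^ (r₁ - i - j) * countFixed s r₂ j p₂ := by
  unfold countCoarser
  simp_rw [Nat.range_succ_eq_Icc_zero]
  refine Finset.sum_subset (Finset.Icc_subset_Icc_left p₁.zero_le) fun i _ hi => ?_
  rw [Nat.stirlingSecond_eq_zero_of_lt (by grind), mul_zero, zero_mul]

theorem sum_choose_mul_countFixed_mul_descFactorial (t s m r b : ℕ) :
    ∑ q ∈ range (b + 1),
        (∑ j ∈ range (m + 1), m.choose j * t ^ (m - j) * countFixed s r j q) * b.descFactorial q =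
      (b + t) ^ m * (b + s) ^ r :=
  calc
    _ = ∑ j ∈ range (m + 1), m.choose j * t ^ (m - j) *
          ∑ q ∈ range (b + 1), countFixed s r j q * b.descFactorial q := by
      simp_rw [Finset.sum_mul, Finset.mul_sum, mul_assoc]
      exact Finset.sum_comm
    _ = (∑ j ∈ range (m + 1), m.choose j * t ^ (m - j) * b ^ j) * (b + s) ^ r := by
      simp_rw [sum_countFixed_mul_descFactorial, Finset.sum_mul, mul_assoc]
    _ = (b + t) ^ m * (b + s) ^ r := by rw [sum_choose_mul_pow_mul_pow]

theorem sum_two_pow_mul_stirlingSecond_mul_descFactorial (i a : ℕ) :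
    ∑ p ∈ range (a + 1), 2 ^ (i - p) * Nat.stirlingSecond i p * (2 ^ p * a.descFactorial p) =
      (2 * a) ^ i := by
  rw [mul_pow, pow_eq_sum_stirlingSecond_mul_descFactorial a i, Finset.mul_sum]
  refine Finset.sum_congr rfl fun p _ => ?_
  rcases lt_or_ge i p with hip | hip
  · simp [Nat.stirlingSecond_eq_zero_of_lt hip]
  · rw [← Nat.sub_add_cancel hip, pow_add, Nat.add_sub_cancel]
    ring

theorem sum_countCoarser_mul_descFactorial (t s r₁ r₂ a b : ℕ) :
    ∑ p₁ ∈ range (a + 1), (∑ p₂ ∈ range (b + 1),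
        countCoarser t s r₁ r₂ p₁ p₂ * b.descFactorial p₂) * (2 ^ p₁ * a.descFactorial p₁) =
      (2 * a + (b + t)) ^ r₁ * (b + s) ^ r₂ := by
  have hp₂ (p₁ : ℕ) : ∑ p₂ ∈ range (b + 1), countCoarser t s r₁ r₂ p₁ p₂ * b.descFactorial p₂ =
      ∑ i ∈ range (r₁ + 1), r₁.choose i * 2 ^ (i - p₁) * Nat.stirlingSecond i p₁ *
        ((b + t) ^ (r₁ - i) * (b + s) ^ r₂) := by
    simp_rw [countCoarser_eq_sum_range, Finset.sum_mul]
    rw [Finset.sum_comm]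
    refine Finset.sum_congr rfl fun i _ => ?_
    simp_rw [← sum_choose_mul_countFixed_mul_descFactorial, mul_assoc, Finset.mul_sum]
  calc
    _ = ∑ i ∈ range (r₁ + 1), r₁.choose i * (b + t) ^ (r₁ - i) * (b + s) ^ r₂ *
          ∑ p ∈ range (a + 1), 2 ^ (i - p) * Nat.stirlingSecond i p *
            (2 ^ p * a.descFactorial p) := by
      simp_rw [hp₂, Finset.sum_mul, Finset.mul_sum]
      rw [Finset.sum_comm]
      exact Finset.sum_congr rfl fun i _ => Finset.sum_congr rfl fun p _ => by ring
    _ = (∑ i ∈ range (r₁ + 1), r₁.choose i * (b + t) ^ (r₁ - i) * (2 * a) ^ i) *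
          (b + s) ^ r₂ := by
      simp_rw [sum_two_pow_mul_stirlingSecond_mul_descFactorial, Finset.sum_mul]
      exact Finset.sum_congr rfl fun i _ => by ring
    _ = (2 * a + (b + t)) ^ r₁ * (b + s) ^ r₂ := by rw [sum_choose_mul_pow_mul_pow]

theorem eq_countCoarser {t s r₁ r₂ : ℕ} {N : ℕ → ℕ → ℕ}
    (hN : ∀ a b, ∑ p₁ ∈ range (a + 1), (∑ p₂ ∈ range (b + 1), N p₁ p₂ * b.descFactorial p₂) *
        (2 ^ p₁ * a.descFactorial p₁) = (2 * a + (b + t)) ^ r₁ * (b + s) ^ r₂) (p₁ p₂ : ℕ) :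
    N p₁ p₂ = countCoarser t s r₁ r₂ p₁ p₂ := by
  let weight (N : ℕ → ℕ → ℕ) (b p : ℕ) := (∑ q ∈ range (b + 1), N p q * b.descFactorial q) * 2 ^ p
  have hweight (b : ℕ) : weight N b = weight (countCoarser t s r₁ r₂) b :=
    eq_of_sum_mul_descFactorial_eq fun a => by
      simpa only [weight, mul_assoc] using
        (hN a b).trans (sum_countCoarser_mul_descFactorial t s r₁ r₂ a b).symm
  exact congrFun (eq_of_sum_mul_descFactorial_eq fun b =>
    Nat.eq_of_mul_eq_mul_right (by positivity) (congrFun (hweight b) p₁)) p₂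

theorem countCoarser_zero_left (t s r₂ p₂ : ℕ) :
    countCoarser t s 0 r₂ 0 p₂ = countFixed s r₂ 0 p₂ := by
  simp [countCoarser]

theorem countFixed_zero (r j q : ℕ) : countFixed 0 r j q = Nat.stirlingSecond (r + j) q := by
  rw [countFixed_eq_sum_range, Finset.sum_range_succ, Finset.sum_eq_zero fun l hl => ?_]
  · simp
  · rw [zero_pow (by grind), mul_zero, zero_mul]

theorem countCoarser_zero_zero (r₁ r₂ p₁ p₂ : ℕ) :
    countCoarser 0 0 r₁ r₂ p₁ p₂ =
      ∑ i ∈ Icc p₁ r₁, r₁.choose i * 2 ^ (i - p₁) * Nat.stirlingSecond i p₁ *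
        Nat.stirlingSecond (r₂ + (r₁ - i)) p₂ := by
  refine Finset.sum_congr rfl fun i _ => ?_
  rw [Finset.sum_eq_single_of_mem (r₁ - i) (by simp) fun j hj hne => ?_]
  · simp [countFixed_zero]
  · rw [zero_pow (by grind), mul_zero, zero_mul]

theorem sum_ite_eq_descFactorial (x n : ℕ) :
    (∑ k ∈ range (x + 1), if n = k then x.descFactorial k else 0) = x.descFactorial n := by
  rw [Finset.sum_ite_eq]
  refine ite_eq_left_iff.2 fun h => (Nat.descFactorial_eq_zero_iff_lt.2 ?_).symm
  rwa [Finset.mem_range_succ_iff, not_le] at h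

theorem sum_card_filter_mul_descFactorial {ι : Type*} [Fintype ι] (f g : ι → ℕ) (a b : ℕ) :
    ∑ p ∈ range (a + 1), (∑ q ∈ range (b + 1), #{i | f i = p ∧ g i = q} * b.descFactorial q) *
        (2 ^ p * a.descFactorial p) =
      ∑ i, b.descFactorial (g i) * (2 ^ f i * a.descFactorial (f i)) := by
  have hq (p : ℕ) : ∑ q ∈ range (b + 1), #{i | f i = p ∧ g i = q} * b.descFactorial q =
      ∑ i, if f i = p then b.descFactorial (g i) else 0 := by
    simp_rw [Finset.card_filter, Finset.sum_mul, ite_and, ite_mul, one_mul, zero_mul]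
    rw [Finset.sum_comm]
    simp_rw [Finset.sum_ite_irrel, Finset.sum_const_zero, sum_ite_eq_descFactorial]
  simp_rw [hq, Finset.sum_mul, ite_mul, zero_mul]
  rw [Finset.sum_comm]
  refine Finset.sum_congr rfl fun i _ => ?_
  rw [← sum_ite_eq_descFactorial a (f i), Finset.mul_sum, Finset.mul_sum]
  refine Finset.sum_congr rfl fun p _ => ?_
  split_ifs with h
  · rw [h]
  · simp

theorem card_embedding (α β : Type*) [Finite α] [Finite β] :
    Nat.card (α ↪ β) = (Nat.card β).descFactorial (Nat.card α) := by
  classical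
  have := Fintype.ofFinite α
  have := Fintype.ofFinite β
  simp only [Nat.card_eq_fintype_card, Fintype.card_embedding_eq]

/-! ### Sets with an involution -/

namespace Z2Set

section

universe u

variable {Q : Type u} {Y T A B A' B' : Type*}

/-- A map out of a set with involution that is equivariant and restricts to `i` along `j`. -/
structure IsExtension (σ : Q → Q) (υ : Y → Y) (j : T → Q) (i : T → Y) (f : Q → Y) : Prop where
  semiconj : Semiconj f σ υ
  comp_eq : f ∘ j = i

/-- The number of points outside the range of `j` that are moved by `σ`, which is twice the number
of free orbits. For the components of a diagram, with `j` the inclusion of the through classes, it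
is the number of `{e}`-horizontal edges. -/
noncomputable def numFree (σ : Q → Q) (j : T → Q) : ℕ := {q | q ∉ Set.range j ∧ σ q ≠ q}.ncard

/-- The number of points outside the range of `j` that are fixed by `σ`. For the components of a
diagram, with `j` the inclusion of the through classes, it is the number of `ℤ₂`-horizontal
edges. -/
noncomputable def numFixed (σ : Q → Q) (j : T → Q) : ℕ := {q | q ∉ Set.range j ∧ σ q = q}.ncard

/-- The normal form of a set with involution that contains `T`: outside `T` it consists of the free
orbits `{a} × Bool` for `a : A` and of the fixed points `b : B`. -/
abbrev Model (T A B : Type*) := T ⊕ (A × Bool) ⊕ B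

/-- The involution of the model that restricts to `τ` on `T`. -/
def Model.invol (τ : T → T) : Model T A B → Model T A B :=
  Sum.map τ (Sum.map (Prod.map id not) id)

theorem mem_range_iff_of_semiconj {σ : Q → Q} {τ : T → T} {j : T → Q} (hσ : Involutive σ)
    (hjσ : Semiconj j τ σ) {q : Q} : σ q ∈ Set.range j ↔ q ∈ Set.range j := by
  have h {q : Q} : q ∈ Set.range j → σ q ∈ Set.range j := by
    rintro ⟨t, rfl⟩
    exact ⟨τ t, hjσ t⟩
  exact ⟨fun hq => hσ q ▸ h hq, h⟩

theorem exists_prod_bool_equiv {σ : Q → Q} (hσ : Involutive σ) (hfree : ∀ q, σ q ≠ q) :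
    ∃ (A : Set Q) (φ : A × Bool ≃ Q), Semiconj φ (Prod.map id not) σ := by
  let _ : LinearOrder Q := by classical exact linearOrderOfSTO WellOrderingRel
  let A : Set Q := {q | q < σ q}
  let φ : A × Bool → Q := fun a => bif a.2 then σ a.1 else a.1
  have φ_injective : Injective φ := by
    rintro ⟨a, _ | _⟩ ⟨a', _ | _⟩ h <;> simp only [φ, cond_true, cond_false] at h
    · rw [Subtype.ext h]
    · exact absurd a.2 (by rw [h, Set.mem_ofPred, hσ]; exact a'.2.not_gt)
    · exact absurd a'.2 (by rw [← h, Set.mem_ofPred, hσ]; exact a.2.not_gt)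
    · rw [Subtype.ext (hσ.injective h)]
  have φ_surjective : Surjective φ := fun q => by
    rcases (hfree q).symm.lt_or_gt with h | h
    · exact ⟨(⟨q, h⟩, false), rfl⟩
    · exact ⟨(⟨σ q, by rwa [Set.mem_ofPred, hσ q]⟩, true), hσ q⟩
  refine ⟨A, Equiv.ofBijective φ ⟨φ_injective, φ_surjective⟩, ?_⟩
  rintro ⟨a, _ | _⟩
  · rfl
  · exact (hσ a).symm

theorem exists_model_equiv {σ : Q → Q} {τ : T → T} {j : T → Q} (hσ : Involutive σ)
    (hj : Injective j) (hjσ : Semiconj j τ σ) :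
    ∃ (A B : Type u) (φ : Model T A B ≃ Q), IsExtension (Model.invol τ) σ Sum.inl j φ := by
  let P := {q // q ∉ Set.range j ∧ σ q ≠ q}
  let B := {q // q ∉ Set.range j ∧ σ q = q}
  let σP : P → P := Subtype.map σ fun q hq =>
    ⟨mt (mem_range_iff_of_semiconj hσ hjσ).1 hq.1, fun h => hq.2 (hσ.injective h)⟩
  obtain ⟨A, ψ, hψ⟩ := exists_prod_bool_equiv (σ := σP) (fun q => Subtype.ext (hσ q))
    fun q h => q.2.2 (congrArg Subtype.val h)
  let φ : Model T A B → Q := Sum.elim j (Sum.elim (fun a => ψ a) (↑))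
  have φ_injective : Injective φ := by
    refine hj.sumElim ((Subtype.val_injective.comp ψ.injective).sumElim Subtype.val_injective
      fun a b h => (ψ a).2.2 ?_) ?_
    · rw [show (ψ a : Q) = b from h, b.2.2]
    · rintro t (a | b) h
      · exact (ψ a).2.1 ⟨t, h⟩
      · exact b.2.1 ⟨t, h⟩
  have φ_surjective : Surjective φ := fun q => by
    by_cases hq : q ∈ Set.range j
    · obtain ⟨t, rfl⟩ := hq
      exact ⟨Sum.inl t, rfl⟩
    by_cases hσq : σ q = q
    · exact ⟨Sum.inr (Sum.inr ⟨q, hq, hσq⟩), rfl⟩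
    · exact ⟨Sum.inr (Sum.inl (ψ.symm ⟨q, hq, hσq⟩)), congrArg Subtype.val (ψ.apply_symm_apply _)⟩
  refine ⟨A, B, Equiv.ofBijective φ ⟨φ_injective, φ_surjective⟩, ?_, rfl⟩
  rintro (t | a | b)
  · exact hjσ t
  · exact congrArg Subtype.val (hψ a)
  · exact b.2.2.symm

section

variable {Q' : Type*} {σ : Q → Q} {σ' : Q' → Q'} {υ : Y → Y} {j : T → Q} {j' : T → Q'} {i : T → Y}
  {φ : Q ≃ Q'}

theorem numFree_congr (hφ : IsExtension σ σ' j j' φ) : numFree σ j = numFree σ' j' := by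
  have h : {q | q ∉ Set.range j ∧ σ q ≠ q} = φ ⁻¹' {q | q ∉ Set.range j' ∧ σ' q ≠ q} := by
    ext q
    simp [← hφ.semiconj.eq, ← hφ.comp_eq]
  rw [numFree, h, Set.ncard_preimage_of_injective_subset_range φ.injective (by simp), numFree]

theorem numFixed_congr (hφ : IsExtension σ σ' j j' φ) : numFixed σ j = numFixed σ' j' := by
  have h : {q | q ∉ Set.range j ∧ σ q = q} = φ ⁻¹' {q | q ∉ Set.range j' ∧ σ' q = q} := by
    ext q
    simp [← hφ.semiconj.eq, ← hφ.comp_eq]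
  rw [numFixed, h, Set.ncard_preimage_of_injective_subset_range φ.injective (by simp), numFixed]

theorem isExtension_comp_iff (hφ : IsExtension σ σ' j j' φ) {f : Q' → Y} :
    IsExtension σ υ j i (f ∘ φ) ↔ IsExtension σ' υ j' i f := by
  constructor
  · rintro ⟨h, h'⟩
    refine ⟨fun q => ?_, ?_⟩
    · simpa [hφ.semiconj.eq] using h (φ.symm q)
    · rw [← hφ.comp_eq, ← h', comp_assoc]
  · rintro ⟨h, h'⟩
    exact ⟨h.comp_left hφ.semiconj, by rw [comp_assoc, hφ.comp_eq, h']⟩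

end

theorem numFree_model {τ : T → T} :
    numFree (Model.invol τ) (Sum.inl : T → Model T A B) = 2 * Nat.card A := by
  have h : {q | q ∉ Set.range (Sum.inl : T → Model T A B) ∧ Model.invol τ q ≠ q} =
      Set.range (Sum.inr ∘ Sum.inl) := by
    ext (t | ⟨a, x⟩ | b) <;> simp [Model.invol]
  rw [numFree, h, ← Nat.card_coe_set_eq,
    Nat.card_range_of_injective (Sum.inr_injective.comp Sum.inl_injective), Nat.card_prod,
    Nat.card_eq_fintype_card (α := Bool), Fintype.card_bool, mul_comm]

theorem numFixed_model {τ : T → T} :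
    numFixed (Model.invol τ) (Sum.inl : T → Model T A B) = Nat.card B := by
  have h : {q | q ∉ Set.range (Sum.inl : T → Model T A B) ∧ Model.invol τ q = q} =
      Set.range (Sum.inr ∘ Sum.inr) := by
    ext (t | ⟨a, x⟩ | b) <;> simp [Model.invol]
  rw [numFixed, h, ← Nat.card_coe_set_eq,
    Nat.card_range_of_injective (Sum.inr_injective.comp Sum.inr_injective)]

theorem card_isExtension_model {τ : T → T} {υ : Y → Y} {i : T → Y} (hυ : Involutive υ)
    (hi : Semiconj i τ υ) [Finite A] [Finite B] :
    Nat.card {f : Model T A B → Y // IsExtension (Model.invol τ) υ Sum.inl i f} =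
      Nat.card Y ^ Nat.card A * Nat.card {y // υ y = y} ^ Nat.card B := by
  let extend (u : (A → Y) × (B → {y // υ y = y})) : Model T A B → Y :=
    Sum.elim i (Sum.elim (fun a => bif a.2 then υ (u.1 a.1) else u.1 a.1) (fun b => u.2 b))
  have isExtension_extend u : IsExtension (Model.invol τ) υ Sum.inl i (extend u) := by
    refine ⟨?_, rfl⟩
    rintro (t | ⟨a, _ | _⟩ | b)
    · exact hi t
    · rfl
    · exact (hυ _).symm
    · exact (u.2 b).2.symm
  rw [← Nat.card_fun, ← Nat.card_fun, ← Nat.card_prod]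
  symm
  refine Nat.card_eq_of_bijective (fun u => ⟨extend u, isExtension_extend u⟩) ⟨fun u u' h => ?_, ?_⟩
  · have h' (q) : extend u q = extend u' q := congrFun (congrArg Subtype.val h) q
    exact Prod.ext (funext fun a => h' (Sum.inr (Sum.inl (a, false))))
      (funext fun b => Subtype.ext (h' (Sum.inr (Sum.inr b))))
  · rintro ⟨f, hf, hfi⟩
    refine ⟨(fun a => f (Sum.inr (Sum.inl (a, false))), fun b => ⟨f (Sum.inr (Sum.inr b)),
      (hf (Sum.inr (Sum.inr b))).symm⟩), Subtype.ext (funext ?_)⟩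
    rintro (t | ⟨a, _ | _⟩ | b)
    · exact (congrFun hfi t).symm
    · rfl
    · exact (hf (Sum.inr (Sum.inl (a, false)))).symm
    · rfl

theorem IsExtension.apply_inr_of_injective {τ : T → T} {f : Model T A B → Model T A' B'}
    (hf : IsExtension (Model.invol τ) (Model.invol τ) Sum.inl Sum.inl f) (hfinj : Injective f) :
    (∀ a, ∃ a' ε, f (Sum.inr (Sum.inl (a, false))) = Sum.inr (Sum.inl (a', ε))) ∧
      ∀ b, ∃ b', f (Sum.inr (Sum.inr b)) = Sum.inr (Sum.inr b') := by
  have f_inl (t) : f (Sum.inl t) = Sum.inl t := congrFun hf.comp_eq t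
  constructor
  · intro a
    rcases h : f (Sum.inr (Sum.inl (a, false))) with t | ⟨a', ε⟩ | b
    · exact absurd (hfinj (h.trans (f_inl t).symm)) Sum.inr_ne_inl
    · exact ⟨a', ε, rfl⟩
    · have h' := hf.semiconj (Sum.inr (Sum.inl (a, false)))
      rw [h] at h'
      simpa [Model.invol] using hfinj (h'.trans h.symm)
  · intro b
    rcases h : f (Sum.inr (Sum.inr b)) with t | ⟨a', ε⟩ | b'
    · exact absurd (hfinj (h.trans (f_inl t).symm)) Sum.inr_ne_inl
    · have h' := hf.semiconj (Sum.inr (Sum.inr b))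
      rw [show Model.invol τ (Sum.inr (Sum.inr b) : Model T A B) = Sum.inr (Sum.inr b) from rfl,
        h] at h'
      simp [Model.invol] at h'
    · exact ⟨b', rfl⟩

/-- The map that sends the orbit `a` to the orbit `α a`, exchanging its two points if `ε a` is true,
and the fixed point `b` to `β b`. -/
def Model.map (ε : A → Bool) (α : A → A') (β : B → B') : Model T A B → Model T A' B' :=
  Sum.map id (Sum.map (fun a => (α a.1, xor (ε a.1) a.2)) β)

theorem Model.isExtension_map {τ : T → T} (ε : A → Bool) (α : A → A') (β : B → B') :
    IsExtension (invol τ) (invol τ) Sum.inl Sum.inl (map (T := T) ε α β) := by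
  refine ⟨?_, rfl⟩
  rintro (t | ⟨a, x⟩ | b) <;> simp [map, invol]

theorem Model.map_injective (ε : A → Bool) (α : A ↪ A') (β : B ↪ B') :
    Injective (map (T := T) ε α β) := by
  refine injective_id.sumMap (.sumMap ?_ β.injective)
  rintro ⟨a, x⟩ ⟨a', x'⟩ h
  obtain ⟨h₁, h₂⟩ := Prod.mk.inj h
  obtain rfl := α.injective h₁
  simpa using h₂

theorem IsExtension.exists_eq_map {τ : T → T} {f : Model T A B → Model T A' B'}
    (hf : IsExtension (Model.invol τ) (Model.invol τ) Sum.inl Sum.inl f) (hfinj : Injective f) :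
    ∃ (ε : A → Bool) (α : A ↪ A') (β : B ↪ B'), f = Model.map ε α β := by
  obtain ⟨hA, hB⟩ := hf.apply_inr_of_injective hfinj
  choose α ε hα using hA
  choose β hβ using hB
  have hα' (a : A) (x : Bool) :
      f (Sum.inr (Sum.inl (a, x))) = Sum.inr (Sum.inl (α a, xor (ε a) x)) := by
    cases x
    · simpa using hα a
    · have h := hf.semiconj (Sum.inr (Sum.inl (a, false)))
      rw [hα a] at h
      simpa [Model.invol] using h
  have α_injective : Injective α := fun a a' h => by
    have h' : f (Sum.inr (Sum.inl (a, ε a))) = f (Sum.inr (Sum.inl (a', ε a'))) := by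
      rw [hα', hα', h, Bool.xor_self, Bool.xor_self]
    exact (Prod.mk.inj (Sum.inl_injective (Sum.inr_injective (hfinj h')))).1
  have β_injective : Injective β := fun b b' h =>
    Sum.inr_injective (Sum.inr_injective (hfinj (by rw [hβ, hβ, h])))
  refine ⟨ε, ⟨α, α_injective⟩, ⟨β, β_injective⟩, funext ?_⟩
  rintro (t | ⟨a, x⟩ | b)
  · exact congrFun hf.comp_eq t
  · exact hα' a x
  · exact hβ b

theorem card_injective_isExtension_model {τ : T → T} [Finite A] [Finite B] [Finite A'] [Finite B'] :
    Nat.card {f : Model T A B → Model T A' B' //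
        IsExtension (Model.invol τ) (Model.invol τ) Sum.inl Sum.inl f ∧ Injective f} =
      2 ^ Nat.card A * (Nat.card A').descFactorial (Nat.card A) *
        (Nat.card B').descFactorial (Nat.card B) := by
  rw [← card_embedding, ← card_embedding, ← Fintype.card_bool, ← Nat.card_eq_fintype_card,
    ← Nat.card_fun, ← Nat.card_prod, ← Nat.card_prod]
  refine (Nat.card_eq_of_bijective (fun u => ⟨Model.map u.1.1 u.1.2 u.2,
    Model.isExtension_map _ _ _, Model.map_injective _ _ _⟩) ⟨fun u u' h => ?_, ?_⟩).symm
  · have h' (q) := congrFun (congrArg Subtype.val h) q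
    have hA (a : A) : u.1.2 a = u'.1.2 a ∧ u.1.1 a = u'.1.1 a := by
      simpa [Model.map] using h' (Sum.inr (Sum.inl (a, false)))
    have hB (b : B) : u.2 b = u'.2 b := by simpa [Model.map] using h' (Sum.inr (Sum.inr b))
    exact Prod.ext (Prod.ext (funext fun a => (hA a).2) (DFunLike.ext _ _ fun a => (hA a).1))
      (DFunLike.ext _ _ hB)
  · rintro ⟨f, hf, hfinj⟩
    obtain ⟨ε, α, β, rfl⟩ := hf.exists_eq_map hfinj
    exact ⟨((ε, α), β), rfl⟩

variable {σ : Q → Q} {τ : T → T} {j : T → Q} {υ : Y → Y} {i : T → Y}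

theorem even_numFree (hσ : Involutive σ) (hj : Injective j) (hjσ : Semiconj j τ σ) :
    Even (numFree σ j) := by
  obtain ⟨A, B, φ, hφ⟩ := exists_model_equiv hσ hj hjσ
  rw [← numFree_congr hφ, numFree_model]
  exact even_two_mul _

theorem exists_finite_model_equiv [Finite Q] (hσ : Involutive σ) (hj : Injective j)
    (hjσ : Semiconj j τ σ) {r₁ : ℕ} (hr₁ : numFree σ j = 2 * r₁) :
    ∃ (A B : Type u) (_ : Finite A) (_ : Finite B) (φ : Model T A B ≃ Q),
      IsExtension (Model.invol τ) σ Sum.inl j φ ∧ Nat.card A = r₁ ∧ Nat.card B = numFixed σ j := by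
  obtain ⟨A, B, φ, hφ⟩ := exists_model_equiv hσ hj hjσ
  have : Finite A := .of_injective (fun a => φ (Sum.inr (Sum.inl (a, false))))
    fun a a' h => by simpa using h
  have : Finite B := .of_injective (fun b => φ (Sum.inr (Sum.inr b))) fun b b' h => by simpa using h
  rw [← numFree_congr hφ, numFree_model] at hr₁
  exact ⟨A, B, ‹_›, ‹_›, φ, hφ, Nat.eq_of_mul_eq_mul_left two_pos hr₁,
    by rw [← numFixed_congr hφ, numFixed_model]⟩

theorem card_isExtension [Finite Q] (hσ : Involutive σ) (hj : Injective j) (hjσ : Semiconj j τ σ)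
    (hυ : Involutive υ) (hi : Semiconj i τ υ) {r₁ : ℕ} (hr₁ : numFree σ j = 2 * r₁) :
    Nat.card {f // IsExtension σ υ j i f} =
      Nat.card Y ^ r₁ * Nat.card {y // υ y = y} ^ numFixed σ j := by
  obtain ⟨A, B, _, _, φ, hφ, rfl, hB⟩ := exists_finite_model_equiv hσ hj hjσ hr₁
  rw [← hB, ← card_isExtension_model hυ hi]
  exact Nat.card_congr ((φ.arrowCongr (Equiv.refl Y)).subtypeEquiv fun f => by
    rw [← isExtension_comp_iff hφ]; simp [Equiv.arrowCongr, comp_assoc]).symm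

theorem card_injective_isExtension [Finite Q] [Finite A'] [Finite B'] (hσ : Involutive σ)
    (hj : Injective j) (hjσ : Semiconj j τ σ) {p₁ : ℕ} (hp₁ : numFree σ j = 2 * p₁) :
    Nat.card {f : Q → Model T A' B' // IsExtension σ (Model.invol τ) j Sum.inl f ∧ Injective f} =
      2 ^ p₁ * (Nat.card A').descFactorial p₁ * (Nat.card B').descFactorial (numFixed σ j) := by
  obtain ⟨A, B, _, _, φ, hφ, rfl, hB⟩ := exists_finite_model_equiv hσ hj hjσ hp₁
  rw [← hB, ← card_injective_isExtension_model (τ := τ)]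
  exact Nat.card_congr ((φ.arrowCongr (Equiv.refl _)).subtypeEquiv fun f => by
    rw [← isExtension_comp_iff hφ]; simp [Equiv.arrowCongr, comp_assoc]).symm

/-- An equivalence relation on a set with involution `σ` that corresponds to a coarser diagram: it
is stable under `σ` and does not identify different points of the range of `j` (through classes). -/
structure IsAdmissible (σ : Q → Q) (j : T → Q) (e : Setoid Q) : Prop where
  map_rel : ∀ {x y}, e x y → e (σ x) (σ y)
  injective : Injective (Quotient.mk e ∘ j)

/-- The involution of the quotient by an admissible relation. -/
def IsAdmissible.invol {e : Setoid Q} (he : IsAdmissible σ j e) : Quotient e → Quotient e :=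
  Quotient.map σ fun _ _ => he.map_rel

theorem IsAdmissible.invol_involutive {e : Setoid Q} (he : IsAdmissible σ j e) (hσ : Involutive σ) :
    Involutive he.invol := by
  rintro ⟨q⟩
  exact congrArg (Quotient.mk e) (hσ q)

theorem IsAdmissible.semiconj {e : Setoid Q} (he : IsAdmissible σ j e) (hjσ : Semiconj j τ σ) :
    Semiconj (Quotient.mk e ∘ j) τ he.invol :=
  fun t => congrArg (Quotient.mk e) (hjσ t)

theorem IsExtension.isAdmissible_ker {f : Q → Y} (hf : IsExtension σ υ j i f) (hi : Injective i) :
    IsAdmissible σ j (Setoid.ker f) where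
  map_rel {x y} h := by
    rw [Setoid.ker_def] at h ⊢
    rw [hf.semiconj.eq, hf.semiconj.eq, h]
  injective t t' h := hi (by
    rw [← hf.comp_eq]
    exact Quotient.exact (s := Setoid.ker f) h)

instance [Finite Q] : Finite (Setoid Q) :=
  .of_injective (fun e x y => e x y) fun _ _ h =>
    Setoid.ext fun x y => iff_of_eq (congrFun₂ h x y)

theorem IsAdmissible.isExtension_comp_iff {e : Setoid Q} (he : IsAdmissible σ j e)
    {g : Quotient e → Y} :
    IsExtension he.invol υ (Quotient.mk e ∘ j) i g ↔ IsExtension σ υ j i (g ∘ Quotient.mk e) := by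
  refine ⟨fun h => ⟨fun q => h.semiconj (Quotient.mk e q), h.comp_eq⟩, fun h => ⟨?_, h.comp_eq⟩⟩
  rintro ⟨q⟩
  exact h.semiconj q

theorem ker_comp_mk {e : Setoid Q} {g : Quotient e → Y} (hg : Injective g) :
    Setoid.ker (g ∘ Quotient.mk e) = e := by
  ext x y
  exact hg.eq_iff.trans Quotient.eq

theorem card_isExtension_eq_sum [Finite Q] [Finite Y] [Fintype {e // IsAdmissible σ j e}]
    (hi : Injective i) :
    Nat.card {f // IsExtension σ υ j i f} = ∑ e : {e // IsAdmissible σ j e},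
      Nat.card {g // IsExtension e.2.invol υ (Quotient.mk e.1 ∘ j) i g ∧ Injective g} := by
  rw [← Nat.card_sigma]
  refine (Nat.card_eq_of_bijective
    (fun eg => ⟨eg.2.1 ∘ Quotient.mk eg.1.1, eg.1.2.isExtension_comp_iff.1 eg.2.2.1⟩) ⟨?_, ?_⟩).symm
  · rintro ⟨⟨e, he⟩, g, hg⟩ ⟨⟨e', he'⟩, g', hg'⟩ h
    have hcomp : g ∘ Quotient.mk e = g' ∘ Quotient.mk e' := congrArg Subtype.val h
    obtain rfl : e = e' :=
      (ker_comp_mk hg.2).symm.trans ((congrArg Setoid.ker hcomp).trans (ker_comp_mk hg'.2))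
    obtain rfl : g = g' := Quotient.mk_surjective.injective_comp_right hcomp
    rfl
  · rintro ⟨f, hf⟩
    have he := hf.isAdmissible_ker hi
    exact ⟨⟨⟨Setoid.ker f, he⟩, Setoid.kerLift f,
      he.isExtension_comp_iff.2 hf, Setoid.kerLift_injective f⟩, rfl⟩

theorem card_model [Finite T] (a b : ℕ) :
    Nat.card (Model T (Fin a) (Fin b)) = 2 * a + (b + Nat.card T) := by
  rw [Nat.card_sum, Nat.card_sum, Nat.card_prod, Nat.card_fin, Nat.card_fin,
    Nat.card_eq_fintype_card (α := Bool), Fintype.card_bool]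
  ring

theorem card_fixed_model [Finite T] (a b : ℕ) :
    Nat.card {y : Model T (Fin a) (Fin b) // Model.invol τ y = y} =
      b + Nat.card {t // τ t = t} := by
  have h : {y : Model T (Fin a) (Fin b) | Model.invol τ y = y} =
      Sum.inl '' {t | τ t = t} ∪ Set.range (Sum.inr ∘ Sum.inr) := by
    ext (t | ⟨a, x⟩ | b) <;> simp [Model.invol]
  have hdisj : Disjoint (Sum.inl '' {t | τ t = t} : Set (Model T (Fin a) (Fin b)))
      (Set.range (Sum.inr ∘ Sum.inr)) := by
    rw [Set.disjoint_left]
    rintro _ ⟨t, _, rfl⟩ ⟨b, h⟩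
    exact Sum.inr_ne_inl h
  change Nat.card ({y : Model T (Fin a) (Fin b) | Model.invol τ y = y} : Set _) = _
  rw [h, Nat.card_coe_set_eq, Set.ncard_union_eq hdisj,
    Set.ncard_image_of_injective _ Sum.inl_injective,
    Set.ncard_range_of_injective (Sum.inr_injective.comp Sum.inr_injective), Nat.card_fin, add_comm]
  rfl

theorem IsAdmissible.numFree_le [Finite Q] {e : Setoid Q} (he : IsAdmissible σ j e) :
    numFree he.invol (Quotient.mk e ∘ j) ≤ numFree σ j := by
  refine (Set.ncard_le_ncard (t := Quotient.mk e '' {q | q ∉ Set.range j ∧ σ q ≠ q}) ?_).trans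
    Set.ncard_image_le
  rintro ⟨q⟩ ⟨hq, hσq⟩
  refine ⟨q, ⟨?_, fun h => hσq (congrArg (Quotient.mk e) h)⟩, rfl⟩
  rintro ⟨t, rfl⟩
  exact hq ⟨t, rfl⟩

/-- The admissible relations whose quotient has `p₁` free orbits and `p₂` fixed points outside the
image of `T`. -/
def admissible (σ : Q → Q) (j : T → Q) (p₁ p₂ : ℕ) : Set (Setoid Q) :=
  {e | ∃ he : IsAdmissible σ j e,
    numFree he.invol (Quotient.mk e ∘ j) = 2 * p₁ ∧ numFixed he.invol (Quotient.mk e ∘ j) = p₂}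

theorem sum_ncard_admissible_mul_descFactorial [Finite Q] (hσ : Involutive σ) (hj : Injective j)
    (hjσ : Semiconj j τ σ) (a b : ℕ) :
    ∑ p₁ ∈ range (a + 1), (∑ p₂ ∈ range (b + 1),
        (admissible σ j p₁ p₂).ncard * b.descFactorial p₂) * (2 ^ p₁ * a.descFactorial p₁) =
      Nat.card {f : Q → Model T (Fin a) (Fin b) // IsExtension σ (Model.invol τ) j Sum.inl f} := by
  classical
  have : Finite T := .of_injective j hj
  have := Fintype.ofFinite {e // IsAdmissible σ j e}
  choose half hhalf using fun e : {e // IsAdmissible σ j e} =>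
    even_iff_exists_two_mul.1
      (even_numFree (e.2.invol_involutive hσ) e.2.injective (e.2.semiconj hjσ))
  have hcard (p₁ p₂ : ℕ) : (admissible σ j p₁ p₂).ncard =
      #{e | half e = p₁ ∧ numFixed e.2.invol (Quotient.mk e.1 ∘ j) = p₂} := by
    rw [← Set.ncard_coe_finset, ← Set.ncard_image_of_injective _ Subtype.val_injective]
    congr 1
    ext e
    simp only [admissible, Finset.coe_filter_univ, Set.mem_image, Set.mem_ofPred, Subtype.exists,
      exists_and_right, exists_eq_right]
    exact exists_congr fun he => and_congr_left' (by rw [hhalf ⟨e, he⟩]; omega)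
  simp_rw [card_isExtension_eq_sum Sum.inl_injective, hcard, sum_card_filter_mul_descFactorial]
  refine Finset.sum_congr rfl fun e _ => ?_
  rw [card_injective_isExtension (e.2.invol_involutive hσ) e.2.injective (e.2.semiconj hjσ)
    (hhalf e), Nat.card_fin, Nat.card_fin, mul_comm]

theorem ncard_admissible [Finite Q] (hσ : Involutive σ) (hj : Injective j)
    (hjσ : Semiconj j τ σ) {r₁ r₂ : ℕ} (hr₁ : numFree σ j = 2 * r₁) (hr₂ : numFixed σ j = r₂)
    (p₁ p₂ : ℕ) : (admissible σ j p₁ p₂).ncard =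
      countCoarser (Nat.card T) (Nat.card {t // τ t = t}) r₁ r₂ p₁ p₂ := by
  have : Finite T := .of_injective j hj
  have hτ : Involutive τ := fun t => hj (by rw [hjσ, hjσ, hσ])
  have hinvol (a b : ℕ) : Involutive (Model.invol τ : Model T (Fin a) (Fin b) → _) := by
    rintro (t | ⟨a, x⟩ | b) <;> simp [Model.invol, hτ _]
  refine eq_countCoarser (N := fun p₁ p₂ => (admissible σ j p₁ p₂).ncard) (fun a b => ?_) p₁ p₂
  rw [sum_ncard_admissible_mul_descFactorial hσ hj hjσ,
    card_isExtension hσ hj hjσ (hinvol a b) (fun _ => rfl) hr₁, card_model, card_fixed_model, hr₂]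

end

end Z2Set

/-! ### Diagrams over a set with involution -/

namespace TwoRow

section Involution

variable {X : Type} (σ : X → X) (d d' : Setoid (X ⊕ X))

/-- Stability under a map `σ` of the vertices of a row to themselves, acting on both rows. -/
def IsStable : Prop :=
  ∀ p q : X ⊕ X, d p q → d (Sum.map σ σ p) (Sum.map σ σ q)

/-- An `{e}`-class, for the action of `ℤ₂` through `σ`. -/
def IsEClass (C : Set (X ⊕ X)) : Prop :=
  C ∈ d.classes ∧ ∀ p ∈ C, Sum.map σ σ p ∉ C

/-- A `ℤ₂`-class, for the action of `ℤ₂` through `σ`. -/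
def IsZ2Class (C : Set (X ⊕ X)) : Prop :=
  C ∈ d.classes ∧ ∀ p ∈ C, Sum.map σ σ p ∈ C

/-- The analogue of `J^{2k}_{2s₁+s₂}` for an arbitrary row `X` on which `ℤ₂` acts through `σ`. -/
def J (s₁ s₂ : ℕ) : Set (Setoid (X ⊕ X)) :=
  {d | IsStable σ d ∧ IsDoubled d ∧
    {C | IsThroughClass d C ∧ IsEClass σ d C}.ncard = 2 * s₁ ∧
    {C | IsThroughClass d C ∧ IsZ2Class σ d C}.ncard = s₂}

/-- The number of `{e}`-horizontal edges of the top row. -/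
noncomputable def numEEdges : ℕ :=
  {C | IsTopEdge d C ∧ IsEClass σ d C}.ncard

/-- The number of `ℤ₂`-horizontal edges of the top row. -/
noncomputable def numZ2Edges : ℕ :=
  {C | IsTopEdge d C ∧ IsZ2Class σ d C}.ncard

/-- The relation of the lemma: `d'` is coarser than `d`. -/
def IsCoarser : Prop :=
  (∀ C, IsThroughClass d C → IsEClass σ d C →
    ∃ C', IsThroughClass d' C' ∧ IsEClass σ d' C' ∧ C ⊆ C') ∧
  (∀ C, IsThroughClass d C → IsZ2Class σ d C →
    ∃ C', IsThroughClass d' C' ∧ IsZ2Class σ d' C' ∧ C ⊆ C') ∧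
  (∀ C, IsHorizontalEdge d C → IsEClass σ d C →
    ∃ C', (IsHorizontalEdge d' C' ∨ IsThroughClass d' C') ∧
      (IsEClass σ d' C' ∨ IsZ2Class σ d' C') ∧ C ⊆ C') ∧
  (∀ C, IsHorizontalEdge d C → IsZ2Class σ d C →
    ∃ C', (IsHorizontalEdge d' C' ∨ IsThroughClass d' C') ∧ IsZ2Class σ d' C' ∧ C ⊆ C') ∧
  SeparatesThrough d d'

end Involution

section Component

variable {X : Type} {σ : X → X} {d d' : Setoid (X ⊕ X)} {C : Set (X ⊕ X)} {p : X ⊕ X}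

/-- The connected component of a vertex. -/
def component (d : Setoid (X ⊕ X)) (p : X ⊕ X) : Set (X ⊕ X) := {q | d q p}

theorem component_mem_classes (d : Setoid (X ⊕ X)) (p : X ⊕ X) : component d p ∈ d.classes :=
  ⟨p, rfl⟩

theorem component_mono (h : d ≤ d') (p : X ⊕ X) : component d p ⊆ component d' p :=
  fun _ hq => h hq

theorem isHorizontalEdge_or_isThroughClass_iff :
    IsHorizontalEdge d C ∨ IsThroughClass d C ↔ C ∈ d.classes := by
  refine ⟨?_, fun hC => ?_⟩
  · rintro ((h | h) | h) <;> exact h.1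
  by_cases hl : ∃ x, Sum.inl x ∈ C
  · by_cases hr : ∃ x, Sum.inr x ∈ C
    · exact Or.inr ⟨hC, hl, hr⟩
    · refine Or.inl (Or.inl ⟨hC, ?_⟩)
      rintro (x | x) hx
      · exact ⟨x, rfl⟩
      · exact absurd ⟨x, hx⟩ hr
  · refine Or.inl (Or.inr ⟨hC, ?_⟩)
    rintro (x | x) hx
    · exact absurd ⟨x, hx⟩ hl
    · exact ⟨x, rfl⟩

theorem le_iff_forall_classes : d ≤ d' ↔ ∀ C ∈ d.classes, ∃ C' ∈ d'.classes, C ⊆ C' := by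
  constructor
  · rintro h _ ⟨p, rfl⟩
    exact ⟨_, component_mem_classes d' p, component_mono h p⟩
  · intro h p q hpq
    obtain ⟨C', hC', hsub⟩ := h _ (component_mem_classes d q)
    exact (Setoid.rel_iff_exists_classes d').2 ⟨C', hC', hsub hpq, hsub (d.refl' q)⟩

theorem IsThroughClass.component_of_le (hp : IsThroughClass d (component d p)) (h : d ≤ d') :
    IsThroughClass d' (component d' p) :=
  ⟨component_mem_classes d' p, hp.2.1.imp fun _ hx => h hx, hp.2.2.imp fun _ hx => h hx⟩

theorem IsStable.rel_map_iff (hd : IsStable σ d) {p q : X ⊕ X} (hpq : d p q) :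
    d (Sum.map σ σ p) p ↔ d (Sum.map σ σ q) q :=
  ⟨fun h => d.trans' (d.symm' (hd _ _ hpq)) (d.trans' h hpq),
    fun h => d.trans' (hd _ _ hpq) (d.trans' h (d.symm' hpq))⟩

theorem IsStable.isEClass_component (hd : IsStable σ d) :
    IsEClass σ d (component d p) ↔ ¬ d (Sum.map σ σ p) p := by
  refine ⟨fun h => h.2 p (d.refl' p), fun h => ⟨component_mem_classes d p, fun q hq hq' => h ?_⟩⟩
  exact (hd.rel_map_iff hq).1 (d.trans' hq' (d.symm' hq))

theorem IsStable.isZ2Class_component (hd : IsStable σ d) :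
    IsZ2Class σ d (component d p) ↔ d (Sum.map σ σ p) p := by
  refine ⟨fun h => h.2 p (d.refl' p), fun h => ⟨component_mem_classes d p, fun q hq => ?_⟩⟩
  exact d.trans' ((hd.rel_map_iff hq).2 h) hq

theorem IsStable.isThroughClass_map (hd : IsStable σ d) (hp : IsThroughClass d (component d p)) :
    IsThroughClass d (component d (Sum.map σ σ p)) := by
  obtain ⟨_, ⟨x, hx⟩, y, hy⟩ := hp
  exact ⟨component_mem_classes d _, ⟨σ x, hd _ _ hx⟩, σ y, hd _ _ hy⟩

theorem isCoarser_iff_le_and_separatesThrough (hd : IsStable σ d) (hd' : IsStable σ d') :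
    IsCoarser σ d d' ↔ d ≤ d' ∧ SeparatesThrough d d' := by
  constructor
  · rintro ⟨hTE, hTZ, hHE, hHZ, hsep⟩
    refine ⟨le_iff_forall_classes.2 ?_, hsep⟩
    rintro _ ⟨p, rfl⟩
    rcases isHorizontalEdge_or_isThroughClass_iff.2 (component_mem_classes d p) with hp | hp <;>
      by_cases hσ : d (Sum.map σ σ p) p
    · obtain ⟨C', _, hC', hsub⟩ := hHZ _ hp (hd.isZ2Class_component.2 hσ)
      exact ⟨C', hC'.1, hsub⟩
    · obtain ⟨C', hC', _, hsub⟩ := hHE _ hp (hd.isEClass_component.2 hσ)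
      exact ⟨C', isHorizontalEdge_or_isThroughClass_iff.1 hC', hsub⟩
    · obtain ⟨C', _, hC', hsub⟩ := hTZ _ hp (hd.isZ2Class_component.2 hσ)
      exact ⟨C', hC'.1, hsub⟩
    · obtain ⟨C', _, hC', hsub⟩ := hTE _ hp (hd.isEClass_component.2 hσ)
      exact ⟨C', hC'.1, hsub⟩
  · rintro ⟨hle, hsep⟩
    have horizontal_or_through (p) := isHorizontalEdge_or_isThroughClass_iff.2
      (component_mem_classes d' p)
    refine ⟨?_, ?_, ?_, ?_, hsep⟩
    · rintro _ hC hE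
      obtain ⟨p, rfl⟩ := hC.1
      refine ⟨_, hC.component_of_le hle, hd'.isEClass_component.2 fun hσ => ?_,
        component_mono hle p⟩
      have hmap : component d (Sum.map σ σ p) ⊆ component d' p :=
        fun q hq => d'.trans' (hle hq) hσ
      have heq := hsep _ _ _ (hd.isThroughClass_map hC) hC (component_mem_classes d' p) hmap
        (component_mono hle p)
      exact hd.isEClass_component.1 hE (heq.subset (d.refl' (Sum.map σ σ p)))
    · rintro _ hC hZ
      obtain ⟨p, rfl⟩ := hC.1
      exact ⟨_, hC.component_of_le hle,
        hd'.isZ2Class_component.2 (hle (hd.isZ2Class_component.1 hZ)), component_mono hle p⟩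
    · rintro _ - ⟨⟨p, rfl⟩, -⟩
      refine ⟨_, horizontal_or_through p, ?_, component_mono hle p⟩
      rw [hd'.isEClass_component, hd'.isZ2Class_component]
      exact (em _).symm
    · rintro _ - hZ
      obtain ⟨p, rfl⟩ := hZ.1
      exact ⟨_, horizontal_or_through p,
        hd'.isZ2Class_component.2 (hle (hd.isZ2Class_component.1 hZ)), component_mono hle p⟩

end Component

section Diagram

variable {X Q Q' T : Type} {σ : X → X} {ρ : Q → Q} {τ : T → T} {π : X → Q} {S : Set Q} {S' : Set Q'}
  {j : T → Q} {h : Q → Q'} {q : Q} {x y : X} {C : Set (X ⊕ X)}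

/-- Labels of the vertices by components: the vertices in the top row by `(q, True)`, and the same
for those in the bottom row if `q` is a through class, so that only then the two rows are joined. -/
def label (π : X → Q) (S : Set Q) : X ⊕ X → Q × Prop :=
  Sum.elim (fun x => (π x, True)) (fun x => (π x, π x ∈ S))

/-- The doubled diagram in which `π` maps the top row to its components and `S` is the set of
through classes. -/
def diagram (π : X → Q) (S : Set Q) : Setoid (X ⊕ X) := Setoid.ker (label π S)

theorem diagram_inl_inl : diagram π S (Sum.inl x) (Sum.inl y) ↔ π x = π y :=
  Setoid.ker_def.trans (by simp [label])

theorem diagram_inl_inr : diagram π S (Sum.inl x) (Sum.inr y) ↔ π x = π y ∧ π y ∈ S :=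
  Setoid.ker_def.trans (by simp [label])

theorem diagram_inr_inl : diagram π S (Sum.inr x) (Sum.inl y) ↔ π x = π y ∧ π x ∈ S :=
  Setoid.ker_def.trans (by simp [label])

theorem diagram_inr_inr : diagram π S (Sum.inr x) (Sum.inr y) ↔ π x = π y :=
  Setoid.ker_def.trans (by simp +contextual [label])

theorem isDoubled_diagram (π : X → Q) (S : Set Q) : IsDoubled (diagram π S) :=
  ⟨fun _ _ => diagram_inl_inl.trans diagram_inr_inr.symm, fun x y hxy => by
    rw [diagram_inl_inr] at hxy ⊢
    exact ⟨rfl, hxy.1 ▸ hxy.2⟩⟩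

theorem diagram_le_diagram_iff (hπ : Surjective π) :
    diagram π S ≤ diagram (h ∘ π) S' ↔ Set.MapsTo h S S' := by
  constructor
  · intro hle q hq
    obtain ⟨x, rfl⟩ := hπ q
    exact (diagram_inl_inr.1 (hle (diagram_inl_inr.2 ⟨rfl, hq⟩ : diagram π S (.inl x) (.inr x)))).2
  · rintro hS (x | x) (y | y) hxy
    · exact diagram_inl_inl.2 (congrArg h (diagram_inl_inl.1 hxy))
    · have hxy := diagram_inl_inr.1 hxy
      exact diagram_inl_inr.2 ⟨congrArg h hxy.1, hS hxy.2⟩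
    · have hxy := diagram_inr_inl.1 hxy
      exact diagram_inr_inl.2 ⟨congrArg h hxy.1, hS hxy.2⟩
    · exact diagram_inr_inr.2 (congrArg h (diagram_inr_inr.1 hxy))

theorem diagram_comp_of_injective (hh : Injective h) : diagram (h ∘ π) (h '' S) = diagram π S := by
  ext (x | x) (y | y)
  · simp only [diagram_inl_inl, comp_apply, hh.eq_iff]
  · simp only [diagram_inl_inr, comp_apply, hh.eq_iff, hh.mem_set_image]
  · simp only [diagram_inr_inl, comp_apply, hh.eq_iff, hh.mem_set_image]
  · simp only [diagram_inr_inr, comp_apply, hh.eq_iff]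

/-- The component of the diagram that meets the top row in `π ⁻¹' {q}`. -/
def topClass (π : X → Q) (S : Set Q) (q : Q) : Set (X ⊕ X) := {p | label π S p = (q, True)}

theorem component_diagram_inl (π : X → Q) (S : Set Q) (x : X) :
    component (diagram π S) (Sum.inl x) = topClass π S (π x) :=
  rfl

theorem inl_mem_topClass : Sum.inl x ∈ topClass π S q ↔ π x = q := by
  simp [topClass, label]

theorem inr_mem_topClass : Sum.inr x ∈ topClass π S q ↔ π x = q ∧ q ∈ S := by
  simp +contextual [topClass, label]

theorem topClass_injective (hπ : Surjective π) : Injective (topClass π S) := by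
  intro q q' h
  obtain ⟨x, rfl⟩ := hπ q
  exact inl_mem_topClass.1 (h.subset (inl_mem_topClass.2 rfl))

theorem topClass_mem_classes (hπ : Surjective π) (q : Q) :
    topClass π S q ∈ (diagram π S).classes := by
  obtain ⟨x, rfl⟩ := hπ q
  exact component_mem_classes (diagram π S) (Sum.inl x)

theorem exists_topClass_eq (hC : C ∈ (diagram π S).classes) (hx : Sum.inl x ∈ C) :
    topClass π S (π x) = C := by
  obtain ⟨p, rfl⟩ := hC
  exact Set.ext fun _ => ⟨fun hq => (diagram π S).trans' hq hx,
    fun hq => (diagram π S).trans' hq ((diagram π S).symm' hx)⟩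

theorem isThroughClass_diagram_iff (hπ : Surjective π) :
    IsThroughClass (diagram π S) C ↔ ∃ q ∈ S, topClass π S q = C := by
  constructor
  · rintro ⟨hC, ⟨x, hx⟩, y, hy⟩
    have hCx := exists_topClass_eq hC hx
    exact ⟨π x, (inr_mem_topClass.1 (hCx.superset hy)).2, hCx⟩
  · rintro ⟨q, hq, rfl⟩
    obtain ⟨x, rfl⟩ := hπ q
    exact ⟨topClass_mem_classes hπ _, ⟨x, inl_mem_topClass.2 rfl⟩, x, inr_mem_topClass.2 ⟨rfl, hq⟩⟩

theorem isTopEdge_diagram_iff (hπ : Surjective π) :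
    IsTopEdge (diagram π S) C ↔ ∃ q ∉ S, topClass π S q = C := by
  constructor
  · rintro ⟨hC, hsub⟩
    obtain ⟨p, hp⟩ := Setoid.nonempty_of_mem_partition (Setoid.isPartition_classes _) hC
    obtain ⟨x, rfl⟩ := hsub hp
    have hCx := exists_topClass_eq hC hp
    refine ⟨π x, fun hx => ?_, hCx⟩
    exact Sum.inl_ne_inr (hsub (hCx.subset (inr_mem_topClass.2 ⟨rfl, hx⟩))).choose_spec
  · rintro ⟨q, hq, rfl⟩
    refine ⟨topClass_mem_classes hπ q, ?_⟩
    rintro (x | x) hx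
    · exact ⟨x, rfl⟩
    · exact absurd (inr_mem_topClass.1 hx).2 hq

theorem separatesThrough_diagram_iff (hπ : Surjective π) (hS : Set.MapsTo h S S') :
    SeparatesThrough (diagram π S) (diagram (h ∘ π) S') ↔ Set.InjOn h S := by
  constructor
  · intro hsep q hq q' hq' hqq'
    obtain ⟨x, rfl⟩ := hπ q
    obtain ⟨y, rfl⟩ := hπ q'
    have hle := (diagram_le_diagram_iff hπ).2 hS
    refine topClass_injective hπ (hsep _ _ _ ((isThroughClass_diagram_iff hπ).2 ⟨_, hq, rfl⟩)
      ((isThroughClass_diagram_iff hπ).2 ⟨_, hq', rfl⟩) (component_mem_classes _ _)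
      (component_mono hle (Sum.inl x)) ?_)
    rw [component_diagram_inl, comp_apply, hqq']
    exact component_mono hle (Sum.inl y)
  · intro hinj C₁ C₂ C' hC₁ hC₂ hC' hsub₁ hsub₂
    obtain ⟨q₁, hq₁, rfl⟩ := (isThroughClass_diagram_iff hπ).1 hC₁
    obtain ⟨q₂, hq₂, rfl⟩ := (isThroughClass_diagram_iff hπ).1 hC₂
    obtain ⟨x₁, rfl⟩ := hπ q₁
    obtain ⟨x₂, rfl⟩ := hπ q₂
    have hrel : diagram (h ∘ π) S' (Sum.inl x₁) (Sum.inl x₂) :=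
      (Setoid.rel_iff_exists_classes _).2 ⟨C', hC', hsub₁ (inl_mem_topClass.2 rfl),
        hsub₂ (inl_mem_topClass.2 rfl)⟩
    have hh : (h ∘ π) x₁ = (h ∘ π) x₂ := diagram_inl_inl.1 hrel
    exact congrArg _ (hinj hq₁ hq₂ hh)

theorem ncard_isTopEdge_diagram_and (hπ : Surjective π) (P : Set (X ⊕ X) → Prop) :
    {C | IsTopEdge (diagram π S) C ∧ P C}.ncard = {q | q ∉ S ∧ P (topClass π S q)}.ncard := by
  rw [← Set.ncard_image_of_injective _ (topClass_injective (S := S) hπ)]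
  refine congrArg Set.ncard (Set.ext fun C => ?_)
  rw [Set.mem_ofPred, isTopEdge_diagram_iff hπ]
  constructor
  · rintro ⟨⟨q, hq, rfl⟩, hP⟩
    exact ⟨q, ⟨hq, hP⟩, rfl⟩
  · rintro ⟨q, ⟨hq, hP⟩, rfl⟩
    exact ⟨⟨q, hq, rfl⟩, hP⟩

theorem ncard_isThroughClass_diagram_and (hπ : Surjective π) (hj : Injective j)
    (P : Set (X ⊕ X) → Prop) :
    {C | IsThroughClass (diagram π (Set.range j)) C ∧ P C}.ncard =
      {t | P (topClass π (Set.range j) (j t))}.ncard := by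
  rw [← Set.ncard_image_of_injective _ ((topClass_injective (S := Set.range j) hπ).comp hj)]
  refine congrArg Set.ncard (Set.ext fun C => ?_)
  rw [Set.mem_ofPred, isThroughClass_diagram_iff hπ]
  constructor
  · rintro ⟨⟨_, ⟨t, rfl⟩, rfl⟩, hP⟩
    exact ⟨t, hP, rfl⟩
  · rintro ⟨t, hP, rfl⟩
    exact ⟨⟨j t, ⟨t, rfl⟩, rfl⟩, hP⟩

end Diagram

section Presentation

variable {X Q T : Type} {σ : X → X} {ρ : Q → Q} {τ : T → T} {π : X → Q} {j : T → Q}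
  {d d' : Setoid (X ⊕ X)} {s₁ s₂ : ℕ}

/-- The data that describe a stable doubled diagram up to relabelling: the set `Q` of components of
the top row with the action `ρ` of `ℤ₂` on it, the map `π` of a vertex to its component, and the
inclusion `j` of the set `T` of through classes, with the restricted action `τ`. -/
structure IsPresentation (σ : X → X) (ρ : Q → Q) (τ : T → T) (π : X → Q) (j : T → Q) : Prop where
  surjective : Surjective π
  semiconj_row : Semiconj π σ ρ
  injective : Injective j
  semiconj_through : Semiconj j τ ρ

namespace IsPresentation

theorem involutive (hP : IsPresentation σ ρ τ π j) (hσ : Involutive σ) : Involutive ρ := by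
  intro q
  obtain ⟨x, rfl⟩ := hP.surjective q
  rw [← hP.semiconj_row, ← hP.semiconj_row, hσ]

theorem isStable (hP : IsPresentation σ ρ τ π j) : IsStable σ (diagram π (Set.range j)) := by
  have hmaps : Set.MapsTo ρ (Set.range j) (Set.range j) := by
    rintro _ ⟨t, rfl⟩
    exact ⟨τ t, hP.semiconj_through t⟩
  have hle : diagram π (Set.range j) ≤ diagram (π ∘ σ) (Set.range j) := by
    rw [show π ∘ σ = ρ ∘ π from funext hP.semiconj_row]
    exact (diagram_le_diagram_iff hP.surjective).2 hmaps
  rintro (x | x) (y | y) hxy <;> exact hle hxy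

theorem isZ2Class_topClass_iff (hP : IsPresentation σ ρ τ π j) {q : Q} :
    IsZ2Class σ (diagram π (Set.range j)) (topClass π (Set.range j) q) ↔ ρ q = q := by
  obtain ⟨x, rfl⟩ := hP.surjective q
  rw [← component_diagram_inl, hP.isStable.isZ2Class_component, Sum.map_inl, diagram_inl_inl,
    hP.semiconj_row]

theorem isEClass_topClass_iff (hP : IsPresentation σ ρ τ π j) {q : Q} :
    IsEClass σ (diagram π (Set.range j)) (topClass π (Set.range j) q) ↔ ρ q ≠ q := by
  obtain ⟨x, rfl⟩ := hP.surjective q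
  rw [← component_diagram_inl, hP.isStable.isEClass_component, Sum.map_inl, diagram_inl_inl,
    hP.semiconj_row]

theorem numEEdges_eq (hP : IsPresentation σ ρ τ π j) :
    numEEdges σ (diagram π (Set.range j)) = Z2Set.numFree ρ j := by
  simp_rw [numEEdges, ncard_isTopEdge_diagram_and hP.surjective, hP.isEClass_topClass_iff]
  rfl

theorem numZ2Edges_eq (hP : IsPresentation σ ρ τ π j) :
    numZ2Edges σ (diagram π (Set.range j)) = Z2Set.numFixed ρ j := by
  simp_rw [numZ2Edges, ncard_isTopEdge_diagram_and hP.surjective, hP.isZ2Class_topClass_iff]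
  rfl

theorem mem_J_iff (hP : IsPresentation σ ρ τ π j) :
    diagram π (Set.range j) ∈ J σ s₁ s₂ ↔
      {t | τ t ≠ t}.ncard = 2 * s₁ ∧ {t | τ t = t}.ncard = s₂ := by
  simp only [J, Set.mem_ofPred, hP.isStable, isDoubled_diagram, true_and,
    ncard_isThroughClass_diagram_and hP.surjective hP.injective, hP.isEClass_topClass_iff,
    hP.isZ2Class_topClass_iff, ← hP.semiconj_through.eq, hP.injective.ne_iff, hP.injective.eq_iff]

theorem card_eq_of_mem_J [Finite X] (hP : IsPresentation σ ρ τ π j)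
    (hd : diagram π (Set.range j) ∈ J σ s₁ s₂) : Nat.card T = 2 * s₁ + s₂ := by
  obtain ⟨h₁, h₂⟩ := hP.mem_J_iff.1 hd
  have : Finite Q := .of_surjective π hP.surjective
  have : Finite T := .of_injective j hP.injective
  rw [← h₁, ← h₂, add_comm]
  exact (Set.ncard_add_ncard_compl {t | τ t = t}).symm

theorem quotient (hP : IsPresentation σ ρ τ π j) {e : Setoid Q} (he : Z2Set.IsAdmissible ρ j e) :
    IsPresentation σ he.invol τ (Quotient.mk e ∘ π) (Quotient.mk e ∘ j) where
  surjective := Quotient.mk_surjective.comp hP.surjective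
  semiconj_row x := congrArg (Quotient.mk e) (hP.semiconj_row x)
  injective := he.injective
  semiconj_through := he.semiconj hP.semiconj_through

end IsPresentation

theorem exists_isPresentation (hd : IsStable σ d) (hd' : IsDoubled d) :
    ∃ (Q T : Type) (ρ : Q → Q) (τ : T → T) (π : X → Q) (j : T → Q),
      IsPresentation σ ρ τ π j ∧ d = diagram π (Set.range j) := by
  let π : X → Quotient (d.comap Sum.inl) := Quotient.mk _
  have hπ (x y : X) : π x = π y ↔ d (Sum.inl x) (Sum.inl y) := Quotient.eq
  let S : Set (Quotient (d.comap Sum.inl)) := {q | ∃ x, π x = q ∧ d (Sum.inl x) (Sum.inr x)}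
  have hS (x : X) : π x ∈ S ↔ d (Sum.inl x) (Sum.inr x) := by
    refine ⟨fun ⟨y, hyx, hy⟩ => ?_, fun hx => ⟨x, rfl, hx⟩⟩
    have hxy := (hπ x y).1 hyx.symm
    exact d.trans' hxy (d.trans' hy (d.symm' ((hd'.1 x y).1 hxy)))
  let ρ : Quotient (d.comap Sum.inl) → Quotient (d.comap Sum.inl) :=
    Quotient.map σ fun x y => hd (Sum.inl x) (Sum.inl y)
  have hρ (q) (hq : q ∈ S) : ρ q ∈ S := by
    obtain ⟨x, rfl, hx⟩ := hq
    exact ⟨σ x, rfl, hd _ _ hx⟩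
  refine ⟨_, S, ρ, Subtype.map ρ hρ, π, Subtype.val,
    ⟨Quotient.mk_surjective, fun _ => rfl, Subtype.val_injective, fun _ => rfl⟩, ?_⟩
  have inl_inr_iff (x y : X) : d (Sum.inl x) (Sum.inr y) ↔ π x = π y ∧ π y ∈ S := by
    rw [hπ, hS]
    refine ⟨fun h => ?_, fun h => d.trans' h.1 h.2⟩
    have hxy := (hd'.1 x y).2 (d.trans' (d.symm' (hd'.2 x y h)) h)
    exact ⟨hxy, d.trans' (d.symm' hxy) h⟩
  rw [Subtype.range_coe]
  ext (x | x) (y | y)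
  · rw [diagram_inl_inl, hπ]
  · rw [diagram_inl_inr, inl_inr_iff]
  · rw [d.comm', (diagram π S).comm', diagram_inl_inr, inl_inr_iff]
  · rw [diagram_inr_inr, hπ, hd'.1]

namespace IsPresentation

theorem exists_isAdmissible [Finite X] (hP : IsPresentation σ ρ τ π j)
    (hd : diagram π (Set.range j) ∈ J σ s₁ s₂) (hd' : d' ∈ J σ s₁ s₂)
    (hle : diagram π (Set.range j) ≤ d') (hsep : SeparatesThrough (diagram π (Set.range j)) d') :
    ∃ e, Z2Set.IsAdmissible ρ j e ∧
      d' = diagram (Quotient.mk e ∘ π) (Set.range (Quotient.mk e ∘ j)) := by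
  obtain ⟨Q', T', ρ', τ', π', j', hP', rfl⟩ := exists_isPresentation hd'.1 hd'.2.1
  obtain ⟨h, rfl⟩ : ∃ h, π' = h ∘ π := by
    refine ⟨π' ∘ surjInv hP.surjective, funext fun x => diagram_inl_inl.1 (hle ?_)⟩
    exact diagram_inl_inl.2 (surjInv_eq hP.surjective _).symm
  have hmaps := (diagram_le_diagram_iff hP.surjective).1 hle
  have hinj : Injective (h ∘ j) := fun t t' htt' => hP.injective
    ((separatesThrough_diagram_iff hP.surjective hmaps).1 hsep ⟨t, rfl⟩ ⟨t', rfl⟩ htt')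
  have hρ : Semiconj h ρ ρ' := fun q => by
    obtain ⟨x, rfl⟩ := hP.surjective q
    rw [← hP.semiconj_row]
    exact hP'.semiconj_row x
  have hrange : h '' Set.range j = Set.range j' := by
    have : Finite Q' := .of_surjective _ hP'.surjective
    refine Set.eq_of_subset_of_ncard_le hmaps.image_subset ?_
    rw [← Set.range_comp, Set.ncard_range_of_injective hinj,
      Set.ncard_range_of_injective hP'.injective, hP.card_eq_of_mem_J hd, hP'.card_eq_of_mem_J hd']
  refine ⟨Setoid.ker h, Z2Set.IsExtension.isAdmissible_ker ⟨hρ, rfl⟩ hinj, ?_⟩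
  rw [← hrange, Set.range_comp, ← diagram_comp_of_injective (Setoid.kerLift_injective h),
    ← Set.image_comp]
  rfl

theorem mem_J_and_isCoarser_iff [Finite X] (hP : IsPresentation σ ρ τ π j)
    (hd : diagram π (Set.range j) ∈ J σ s₁ s₂) :
    d' ∈ J σ s₁ s₂ ∧ IsCoarser σ (diagram π (Set.range j)) d' ↔
      ∃ e, Z2Set.IsAdmissible ρ j e ∧
        d' = diagram (Quotient.mk e ∘ π) (Set.range (Quotient.mk e ∘ j)) := by
  constructor
  · rintro ⟨hd', hcoarser⟩
    obtain ⟨hle, hsep⟩ := (isCoarser_iff_le_and_separatesThrough hP.isStable hd'.1).1 hcoarser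
    exact hP.exists_isAdmissible hd hd' hle hsep
  · rintro ⟨e, he, rfl⟩
    have hmaps : Set.MapsTo (Quotient.mk e) (Set.range j) (Set.range (Quotient.mk e ∘ j)) := by
      rw [Set.range_comp]
      exact Set.mapsTo_image _ _
    refine ⟨(hP.quotient he).mem_J_iff.2 (hP.mem_J_iff.1 hd), ?_⟩
    rw [isCoarser_iff_le_and_separatesThrough hP.isStable (hP.quotient he).isStable,
      separatesThrough_diagram_iff hP.surjective hmaps]
    exact ⟨(diagram_le_diagram_iff hP.surjective).2 hmaps, he.injective.injOn_range⟩

theorem diagram_quotient_injective (hP : IsPresentation σ ρ τ π j) :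
    Injective fun e : Setoid Q => diagram (Quotient.mk e ∘ π) (Set.range (Quotient.mk e ∘ j)) := by
  intro e e' h
  ext p q
  obtain ⟨x, rfl⟩ := hP.surjective p
  obtain ⟨y, rfl⟩ := hP.surjective q
  have hxy := Setoid.ext_iff.1 h (Sum.inl x) (Sum.inl y)
  rwa [diagram_inl_inl, diagram_inl_inl, comp_apply, comp_apply, comp_apply, comp_apply,
    Quotient.eq, Quotient.eq] at hxy

theorem setOf_isCoarser_eq_image [Finite X] (hP : IsPresentation σ ρ τ π j)
    (hd : diagram π (Set.range j) ∈ J σ s₁ s₂) (p₁ p₂ : ℕ) :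
    {d' | d' ∈ J σ s₁ s₂ ∧ numEEdges σ d' = 2 * p₁ ∧ numZ2Edges σ d' = p₂ ∧
        IsCoarser σ (diagram π (Set.range j)) d'} =
      (fun e => diagram (Quotient.mk e ∘ π) (Set.range (Quotient.mk e ∘ j))) ''
        Z2Set.admissible ρ j p₁ p₂ := by
  ext d'
  constructor
  · rintro ⟨hd', h₁, h₂, hcoarser⟩
    obtain ⟨e, he, rfl⟩ := (hP.mem_J_and_isCoarser_iff hd).1 ⟨hd', hcoarser⟩
    exact ⟨e, ⟨he, (hP.quotient he).numEEdges_eq ▸ h₁, (hP.quotient he).numZ2Edges_eq ▸ h₂⟩, rfl⟩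
  · rintro ⟨e, ⟨he, h₁, h₂⟩, rfl⟩
    obtain ⟨hJ, hcoarser⟩ := (hP.mem_J_and_isCoarser_iff hd).2 ⟨e, he, rfl⟩
    exact ⟨hJ, (hP.quotient he).numEEdges_eq.trans h₁, (hP.quotient he).numZ2Edges_eq.trans h₂,
      hcoarser⟩

end IsPresentation

theorem ncard_isCoarser [Finite X] (hσ : Involutive σ) (hd : d ∈ J σ s₁ s₂) {r₁ r₂ : ℕ}
    (hr₁ : numEEdges σ d = 2 * r₁) (hr₂ : numZ2Edges σ d = r₂) (p₁ p₂ : ℕ) :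
    {d' | d' ∈ J σ s₁ s₂ ∧ numEEdges σ d' = 2 * p₁ ∧ numZ2Edges σ d' = p₂ ∧
        IsCoarser σ d d'}.ncard = countCoarser (2 * s₁ + s₂) s₂ r₁ r₂ p₁ p₂ := by
  obtain ⟨Q, T, ρ, τ, π, j, hP, rfl⟩ := exists_isPresentation hd.1 hd.2.1
  have : Finite Q := .of_surjective π hP.surjective
  rw [hP.setOf_isCoarser_eq_image hd, Set.ncard_image_of_injective _ hP.diagram_quotient_injective,
    Z2Set.ncard_admissible (hP.involutive hσ) hP.injective hP.semiconj_through
      (hP.numEEdges_eq ▸ hr₁) (hP.numZ2Edges_eq ▸ hr₂), hP.card_eq_of_mem_J hd]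
  congr 1
  exact (Nat.card_coe_set_eq _).trans (hP.mem_J_iff.1 hd).2

theorem IsCoarser.numEEdges_le [Finite X] (hd : d ∈ J σ s₁ s₂) (hd' : d' ∈ J σ s₁ s₂)
    (hcoarser : IsCoarser σ d d') : numEEdges σ d' ≤ numEEdges σ d := by
  obtain ⟨Q, T, ρ, τ, π, j, hP, rfl⟩ := exists_isPresentation hd.1 hd.2.1
  have : Finite Q := .of_surjective π hP.surjective
  obtain ⟨e, he, rfl⟩ := (hP.mem_J_and_isCoarser_iff hd).1 ⟨hd', hcoarser⟩
  rw [hP.numEEdges_eq, (hP.quotient he).numEEdges_eq]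
  exact he.numFree_le

end Presentation

end TwoRow

theorem lemma3p14_general {X : Type} [Finite X] {σ : X → X} (hσ : Involutive σ) {s₁ s₂ r₁ r₂ : ℕ}
    {d : Setoid (X ⊕ X)} (hd : d ∈ TwoRow.J σ s₁ s₂) (hr₁ : TwoRow.numEEdges σ d = 2 * r₁)
    (hr₂ : TwoRow.numZ2Edges σ d = r₂) :
    (∀ p₁ p₂ : ℕ,
      {d' | d' ∈ TwoRow.J σ s₁ s₂ ∧ TwoRow.numEEdges σ d' = 2 * p₁ ∧
          TwoRow.numZ2Edges σ d' = p₂ ∧ TwoRow.IsCoarser σ d d'}.ncard =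
        ∑ i ∈ Icc p₁ r₁, r₁.choose i * 2 ^ (i - p₁) * Nat.stirlingSecond i p₁ *
          ∑ j ∈ Icc 0 (r₁ - i), (r₁ - i).choose j * (2 * s₁ + s₂) ^ (r₁ - i - j) *
            ∑ l ∈ Icc (p₂ - j) r₂, r₂.choose l * s₂ ^ (r₂ - l) * Nat.stirlingSecond (l + j) p₂) ∧
    (r₁ = 0 → ∀ p₂ : ℕ,
      {d' | d' ∈ TwoRow.J σ s₁ s₂ ∧ TwoRow.numZ2Edges σ d' = p₂ ∧
          TwoRow.IsCoarser σ d d'}.ncard =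
        ∑ i ∈ Icc p₂ r₂, r₂.choose i * s₂ ^ (r₂ - i) * Nat.stirlingSecond i p₂) ∧
    (s₁ = 0 → s₂ = 0 → ∀ p₁ p₂ : ℕ,
      {d' | d' ∈ TwoRow.J σ s₁ s₂ ∧ TwoRow.numEEdges σ d' = 2 * p₁ ∧
          TwoRow.numZ2Edges σ d' = p₂ ∧ TwoRow.IsCoarser σ d d'}.ncard =
        ∑ i ∈ Icc p₁ r₁, r₁.choose i * 2 ^ (i - p₁) * Nat.stirlingSecond i p₁ *
          Nat.stirlingSecond (r₂ + (r₁ - i)) p₂) := by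
  have hcount := TwoRow.ncard_isCoarser hσ hd hr₁ hr₂
  refine ⟨hcount, ?_, ?_⟩
  · rintro rfl p₂
    refine Eq.trans (congrArg Set.ncard (Set.ext fun d' => ?_))
      ((hcount 0 p₂).trans (countCoarser_zero_left ..))
    refine and_congr_right fun hd' => (and_iff_right_of_imp fun h => ?_).symm
    exact Nat.le_zero.1 ((h.2.numEEdges_le hd hd').trans hr₁.le)
  · rintro rfl rfl p₁ p₂
    exact (hcount p₁ p₂).trans (countCoarser_zero_zero ..)

namespace Z2Diagram

variable {k : ℕ}

/-- The action of the generator of `ℤ₂` on the vertices of a row. -/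
def swap (p : Row k) : Row k := (p.1, 1 + p.2)

theorem swap_involutive : Involutive (swap (k := k)) := by
  rintro ⟨i, a⟩
  rw [swap, swap, ← add_assoc, show (1 + 1 : ZMod 2) = 0 from rfl, zero_add]

theorem isStable_iff {d : Setoid (Row k ⊕ Row k)} : IsStable d ↔ TwoRow.IsStable swap d := by
  refine ⟨fun h => h 1, fun h g => ?_⟩
  have act_zero (p : Row k ⊕ Row k) : act 0 p = p := by
    rcases p with p | p <;> simp only [act, Sum.map_inl, Sum.map_inr, zero_add]
  fin_cases g
  · intro p q hpq
    exact (act_zero p).symm ▸ (act_zero q).symm ▸ hpq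
  · exact h

theorem J_eq (s₁ s₂ : ℕ) : J k s₁ s₂ = TwoRow.J swap s₁ s₂ :=
  Set.ext fun _ => and_congr_left' isStable_iff

end Z2Diagram

namespace PartitionDiagram

open TwoRow

variable {k : ℕ} {d d' : Setoid (Fin k ⊕ Fin k)} {C : Set (Fin k ⊕ Fin k)}

theorem isStable_id (d : Setoid (Fin k ⊕ Fin k)) : IsStable id d := by
  intro p q hpq
  rwa [Sum.map_id_id]

theorem not_isEClass_id : ¬ IsEClass id d C := by
  rintro ⟨⟨p, rfl⟩, h⟩
  exact h p (d.refl' p) (by rw [Sum.map_id_id]; exact d.refl' p)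

theorem isZ2Class_id_iff : IsZ2Class id d C ↔ C ∈ d.classes := by
  simp only [IsZ2Class, Sum.map_id_id, id, imp_self, implies_true, and_true]

theorem J_eq (s : ℕ) : J k s = TwoRow.J id 0 s := by
  ext d
  have h (C) : IsThroughClass d C ∧ C ∈ d.classes ↔ IsThroughClass d C :=
    and_iff_left_of_imp And.left
  simp [J, TwoRow.J, isStable_id, not_isEClass_id, isZ2Class_id_iff, h]

theorem numEEdges_id (d : Setoid (Fin k ⊕ Fin k)) : numEEdges id d = 0 := by
  simp only [numEEdges, not_isEClass_id, and_false, Set.ofPred_false, Set.ncard_empty]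

theorem numEdges_eq (d : Setoid (Fin k ⊕ Fin k)) : numEdges d = numZ2Edges id d := by
  have h (C) : IsTopEdge d C ∧ C ∈ d.classes ↔ IsTopEdge d C := and_iff_left_of_imp And.left
  simp only [numEdges, numZ2Edges, isZ2Class_id_iff, h]

theorem isCoarser_iff : IsCoarser d d' ↔ TwoRow.IsCoarser id d d' := by
  rw [isCoarser_iff_le_and_separatesThrough (isStable_id d) (isStable_id d'), IsCoarser,
    ← and_assoc]
  refine and_congr_left' ⟨?_, fun hle => ⟨fun C hC => ?_, fun C hC => ?_⟩⟩
  · rintro ⟨hthrough, hhorizontal⟩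
    refine le_iff_forall_classes.2 fun C hC => ?_
    rcases isHorizontalEdge_or_isThroughClass_iff.2 hC with hC | hC
    · obtain ⟨C', hC', hsub⟩ := hhorizontal C hC
      exact ⟨C', isHorizontalEdge_or_isThroughClass_iff.1 hC', hsub⟩
    · obtain ⟨C', hC', hsub⟩ := hthrough C hC
      exact ⟨C', hC'.1, hsub⟩
  · obtain ⟨p, rfl⟩ := hC.1
    exact ⟨_, hC.component_of_le hle, component_mono hle p⟩
  · simp_rw [isHorizontalEdge_or_isThroughClass_iff]
    exact le_iff_forall_classes.1 hle C (isHorizontalEdge_or_isThroughClass_iff.1 (Or.inl hC))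

end PartitionDiagram

theorem lemma3p14 :
    (∀ (k s₁ s₂ r₁ r₂ : ℕ) (d : Setoid (Z2Diagram.Row k ⊕ Z2Diagram.Row k)),
      d ∈ Z2Diagram.J k s₁ s₂ →
      Z2Diagram.numEEdges d = 2 * r₁ → Z2Diagram.numZ2Edges d = r₂ →
      (∀ p₁ p₂ : ℕ,
        {d' | d' ∈ Z2Diagram.J k s₁ s₂ ∧ Z2Diagram.numEEdges d' = 2 * p₁ ∧
            Z2Diagram.numZ2Edges d' = p₂ ∧ Z2Diagram.IsCoarser d d'}.ncard =
          ∑ i ∈ Finset.Icc p₁ r₁,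
            r₁.choose i * 2 ^ (i - p₁) * Nat.stirlingSecond i p₁ *
              ∑ j ∈ Finset.Icc 0 (r₁ - i),
                (r₁ - i).choose j * (2 * s₁ + s₂) ^ (r₁ - i - j) *
                  ∑ l ∈ Finset.Icc (p₂ - j) r₂,
                    r₂.choose l * s₂ ^ (r₂ - l) * Nat.stirlingSecond (l + j) p₂) ∧
      (r₁ = 0 → ∀ p₂ : ℕ,
        {d' | d' ∈ Z2Diagram.J k s₁ s₂ ∧ Z2Diagram.numZ2Edges d' = p₂ ∧
            Z2Diagram.IsCoarser d d'}.ncard =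
          ∑ i ∈ Finset.Icc p₂ r₂, r₂.choose i * s₂ ^ (r₂ - i) * Nat.stirlingSecond i p₂) ∧
      (s₁ = 0 → s₂ = 0 → ∀ p₁ p₂ : ℕ,
        {d' | d' ∈ Z2Diagram.J k s₁ s₂ ∧ Z2Diagram.numEEdges d' = 2 * p₁ ∧
            Z2Diagram.numZ2Edges d' = p₂ ∧ Z2Diagram.IsCoarser d d'}.ncard =
          ∑ i ∈ Finset.Icc p₁ r₁,
            r₁.choose i * 2 ^ (i - p₁) * Nat.stirlingSecond i p₁ *
              Nat.stirlingSecond (r₂ + (r₁ - i)) p₂)) ∧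
    (∀ (k s r : ℕ) (d : Setoid (Fin k ⊕ Fin k)),
      d ∈ PartitionDiagram.J k s → PartitionDiagram.numEdges d = r →
      ∀ p : ℕ,
        {d' | d' ∈ PartitionDiagram.J k s ∧ PartitionDiagram.numEdges d' = p ∧
            PartitionDiagram.IsCoarser d d'}.ncard =
          ∑ i ∈ Finset.Icc p r, r.choose i * s ^ (r - i) * Nat.stirlingSecond i p) := by
  refine ⟨fun k s₁ s₂ r₁ r₂ d hd hr₁ hr₂ => ?_, fun k s r d hd hr p => ?_⟩
  · rw [Z2Diagram.J_eq] at hd ⊢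
    exact lemma3p14_general Z2Diagram.swap_involutive hd hr₁ hr₂
  · simp only [PartitionDiagram.J_eq, PartitionDiagram.numEdges_eq,
      PartitionDiagram.isCoarser_iff] at hd hr ⊢
    exact (lemma3p14_general (fun _ => rfl) hd (PartitionDiagram.numEEdges_id d) hr).2.1 rfl p
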